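/- \textbf{Translation surfaces and saddle connections.} A translation surface is obtained from Euclidean polygons in $\mathbb C$ by identifying parallel edges through translations; the forms $dz$ define a holomorphic $1$-form $\omega$. Its singular points are the zeros of $\omega$, that is, the points with cone angle greater than $2\pi$. A saddle connection is a straight (geodesic) segment of positive length joining two singular points, with no singular point in its interior. It is closed if it joins a singular point to itself. \textbf{Translation cover.} Let $\Pi\subset\mathbb R^3$ be an oriented polyhedral surface tiled by regular $p$-gons of one size and invariant under the translations of a rank-three lattice $\Lambda$, with $\Pi/\Lambda$ compact and connected. The polygons define a flat cone metric on $X=\Pi/\Lambda$, with singularities only at the vertices; let $k$ be the order of the group of rotations by which parallel transport along loops avoiding the vertices acts on tangent vectors. The translation cover of $X$ is the translation surface obtained from $k$ copies of $X$, each rotated by $2\pi/k$ from the previous one, by identifying the edges of the polygons by translations (equivalently: lay out one face of $X$ in the plane, attach to each edge of a placed face a copy of the adjacent face of $X$, and regard two placed copies of the same face as equal if they differ by a translation). It is well defined up to a rotation. \textbf{The surfaces.} Let $D=\{(1,1,1),(1,-1,-1),(-1,1,-1),(-1,-1,1)\}$. \begin{itemize} \item \emph{Mucube} ($p=4$): unit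 cubes $[0,1]^3+\lambda$, $\lambda\in\Lambda=2\mathbb Z^3$, are joined in the six axis directions by square prisms (unit cubes); $\Pi$ is the boundary of this solid. \item \emph{Muoctahedron} ($p=6$): truncated octahedra centred at the points of $\Lambda=4\mathbb Z^3$, with vertices the permutations of $(0,\pm1,\pm2)$ (translated), are glued along their square faces; $\Pi$ consists of their hexagonal faces. \item \emph{Mutetrahedron} ($p=6$): truncate the tetrahedron with vertices $3d$, $d\in D$, at a third of its edges, and take the translates of the result by $\Lambda$, generated by $(0,4,4),(4,0,4),(4,4,0)$; all its triangular faces are glued to regular tetrahedra; $\Pi$ consists of the hexagonal faces. \item \emph{Octa-4} ($p=3$): octahedra congruent to the one with vertices $\pm3e_i$ are centred at the points of $\Lambda$ and of $(4,4,4)+\Lambda$, where $\Lambda$ is generated by $(0,8,8),(8,0,8),(8,8,0)$; for all $\lambda\in\Lambda$, $d\in D$, those centred at $\lambda$ and at $\lambda+4d$ are joined, along their facing triangular faces, by triangular antiprisms with equilateral faces; $\Pi$ is the boundary of this solid. \item \emph{Truncated Octa-8} ($p=4$): truncated octahedra with vertices the permutations of $(0,\pm1,\pm2)$ are translated to the points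 of $\Lambda$, generated by $(2+\sqrt{2/3})\,d$ with $d\in\{\pm1\}^3$; any two of them whose centres differ by such a vector $(2+\sqrt{2/3})\,d$ are joined, along their facing hexagonal faces, by a hexagonal prism with square lateral faces; $\Pi$ is the boundary of this solid. \end{itemize} \textbf{Theorem.} The translation covers of (the quotients $\Pi/\Lambda$ of) Mucube, Muoctahedron, Mutetrahedron, Octa-4 and Truncated Octa-8 have no closed saddle connections: no saddle connection on any of these five translation surfaces joins a singular point to itself. -/

import Mathlib

/-!
Triply periodic polyhedral surfaces tiled by regular polygons, their translation covers, and
saddle connections on these covers.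
-/

noncomputable section

/-! ### Translation surfaces glued from regular polygons -/

/-- The vertex number `j` of the regular `p`-gon inscribed in the unit circle of the complex plane
and turned by the angle `θ`; the vertices are numbered counterclockwise. -/
def regularVertex (p : ℕ) (θ : ℝ) (j : Fin p) : ℂ :=
  Complex.exp (((θ + 2 * Real.pi * (j : ℕ) / p : ℝ) : ℂ) * Complex.I)

/-- A collection of regular Euclidean `p`-gons in the plane (one for each `c : Face`, turned by
the angle `rotation c`), together with the information which edge is glued to which.
The edge number `i` of a polygon goes from its vertex `i` to its vertex `i + 1`
(addition in `Fin p` is modulo `p`). -/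
structure RegularPolygonGluing (p : ℕ) [NeZero p] where
  Face : Type
  rotation : Face → ℝ
  Glued : Face × Fin p → Face × Fin p → Prop

namespace RegularPolygonGluing

variable {p : ℕ} [NeZero p] (S : RegularPolygonGluing p)

/-- The vertex number `j` of the polygon `c`. -/
def vertex (c : S.Face) (j : Fin p) : ℂ := regularVertex p (S.rotation c) j

/-- The closed polygon `c`, as a subset of the plane. -/
def polygon (c : S.Face) : Set ℂ := convexHull ℝ (Set.range (S.vertex c))

/-- The disjoint union of the closed polygons. -/
def PolygonPoint : Type := {x : S.Face × ℂ // x.2 ∈ S.polygon x.1}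

/-- If the edge `i` of the polygon of `x` is glued to the edge `j` of the polygon of `y`, then
the points of the two edges are identified by the translation that takes the initial point of the
first edge to the end point of the second edge. -/
def Identified (x y : S.PolygonPoint) : Prop :=
  ∃ i j : Fin p, S.Glued (x.1.1, i) (y.1.1, j) ∧
    x.1.2 ∈ segment ℝ (S.vertex x.1.1 i) (S.vertex x.1.1 (i + 1)) ∧
    y.1.2 = x.1.2 + (S.vertex y.1.1 (j + 1) - S.vertex x.1.1 i)

/-- The points of the surface: the quotient of the disjoint union of the polygons by the
equivalence relation generated by the identification of the edges. -/
def Point : Type := Quot S.Identified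

/-- The point `z` of the plane belongs to the closed polygon `c` and represents the point `P` of
the surface. -/
def Represents (c : S.Face) (z : ℂ) (P : S.Point) : Prop :=
  ∃ h : z ∈ S.polygon c, Quot.mk S.Identified ⟨(c, z), h⟩ = P

/-- The corners of polygons that come together at a point (none unless it is a vertex). -/
def corners (P : S.Point) : Set (S.Face × Fin p) :=
  {e | S.Represents e.1 (S.vertex e.1 e.2) P}

/-- The cone angle at a vertex: each corner contributes the interior angle `(p - 2) * π / p` of
a regular `p`-gon. (At a point that is not a vertex this expression is `0`.) -/
def vertexAngle (P : S.Point) : ℝ := (S.corners P).ncard * (((p : ℝ) - 2) * Real.pi / p)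

/-- A point is singular (a zero of the holomorphic `1`-form, which in the polygons is `dz`)
if its cone angle exceeds `2 * π`; this can only happen at a vertex. -/
def IsSingular (P : S.Point) : Prop := 2 * Real.pi < S.vertexAngle P

/-- A path `γ`, considered on the interval `[0, 1]`, is a saddle connection with holonomy vector
`z ≠ 0` if its two ends are singular points, no interior point is singular, and it runs straight
in the direction `z` with constant speed: near each `t`, the piece after `t` and the piece
before `t` are each given inside a closed polygon by `s ↦ x + s * z`, respectively
`s ↦ x - s * z`. (At a regular point the surface has total angle `2 * π`, so there is just one way
to go on in the direction `z`, and it makes the angle `π` with the way back in the direction `-z`.)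
Segments that run along the edges of polygons, or through regular vertices, are included. -/
def IsSaddleConnectionWithHolonomy (γ : ℝ → S.Point) (z : ℂ) : Prop :=
  z ≠ 0 ∧
  (∀ t ∈ Set.Ico (0 : ℝ) 1, ∃ (c : S.Face) (x : ℂ) (ε : ℝ), 0 < ε ∧
    ∀ s ∈ Set.Icc (0 : ℝ) ε, S.Represents c (x + (s : ℂ) * z) (γ (t + s))) ∧
  (∀ t ∈ Set.Ioc (0 : ℝ) 1, ∃ (c : S.Face) (x : ℂ) (ε : ℝ), 0 < ε ∧
    ∀ s ∈ Set.Icc (0 : ℝ) ε, S.Represents c (x - (s : ℂ) * z) (γ (t - s))) ∧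
  S.IsSingular (γ 0) ∧ S.IsSingular (γ 1) ∧ ∀ t ∈ Set.Ioo (0 : ℝ) 1, ¬ S.IsSingular (γ t)

/-- `γ`, considered on `[0, 1]`, is a saddle connection. -/
def IsSaddleConnection (γ : ℝ → S.Point) : Prop :=
  ∃ z : ℂ, S.IsSaddleConnectionWithHolonomy γ z

/-- `γ` is a closed saddle connection: it joins a singular point to itself. -/
def IsClosedSaddleConnection (γ : ℝ → S.Point) : Prop :=
  S.IsSaddleConnection γ ∧ γ 0 = γ 1

end RegularPolygonGluing

/-! ### Triply periodic polyhedral surfaces and their translation covers -/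

/-- A triply periodic polyhedral surface in `ℝ³` tiled by regular `p`-gons, all of one size.
`Face` numbers the polygons up to translations of the lattice `Λ`
spanned by the three vectors `period`, and `vertex f` lists the vertices of a representative of the
face `f`, counterclockwise as seen from the outer side of the surface. The surface in `ℝ³` consists
of all translates of these polygons by vectors of `Λ`. -/
structure PeriodicPolyhedralSurface (p : ℕ) [NeZero p] where
  Face : Type
  vertex : Face → Fin p → (Fin 3 → ℝ)
  period : Fin 3 → (Fin 3 → ℝ)

namespace PeriodicPolyhedralSurface

variable {p : ℕ} [NeZero p] (X : PeriodicPolyhedralSurface p)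

/-- In the quotient of the surface by `Λ`, the edge `i` of the face `f` is the edge `j` of the face
`g`: some translation in `Λ` takes the second edge to the first, reversing the orientation that the
edges have as parts of the oriented boundaries of the two faces. -/
def SameEdge (e e' : X.Face × Fin p) : Prop :=
  ∃ m : Fin 3 → ℤ,
    X.vertex e.1 e.2 = X.vertex e'.1 (e'.2 + 1) + ∑ a, (m a : ℝ) • X.period a ∧
    X.vertex e.1 (e.2 + 1) = X.vertex e'.1 e'.2 + ∑ a, (m a : ℝ) • X.period a

/-- A face laid out in the plane, turned by the angle `π * m / p`, where `m` is its second
component. -/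
abbrev PlacedFace : Type := X.Face × Fin (2 * p)

/-- The angle by which a placed face is turned. -/
def placedAngle (c : X.PlacedFace) : ℝ := Real.pi * (c.2 : ℕ) / p

/-- The oriented edge number `i` of a placed face, as a vector in the plane. -/
def edgeVector (c : X.PlacedFace) (i : Fin p) : ℂ :=
  regularVertex p (X.placedAngle c) (i + 1) - regularVertex p (X.placedAngle c) i

/-- Edges of placed faces are glued if they are the same edge of the quotient surface and the
gluing is by a translation (that is, as sides of the two polygons, they are opposite vectors). -/
def PlacedGlued (e e' : X.PlacedFace × Fin p) : Prop :=
  X.SameEdge (e.1.1, e.2) (e'.1.1, e'.2) ∧ X.edgeVector e.1 e.2 = - X.edgeVector e'.1 e'.2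

/-- Two placed faces are adjacent if an edge of one is glued to an edge of the other. -/
def Adjacent (c c' : X.PlacedFace) : Prop := ∃ i j : Fin p, X.PlacedGlued (c, i) (c', j)

/-- The translation cover (unfolding) of the quotient of the surface by `Λ`: starting with the face
`f₀` in a standard position, one adds the neighbours of the faces already placed,
each turned such that its edge is glued by a translation, until nothing new appears. If
the rotational part of the holonomy of the flat cone metric has order `k`, then each face occurs in
exactly `k` positions, which differ by rotations by multiples of `2 * π / k`. Another choice of
`f₀` gives the same translation surface up to a rotation. -/
def translationCover (f₀ : X.Face) : RegularPolygonGluing p where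
  Face := {c : X.PlacedFace // Relation.ReflTransGen X.Adjacent (f₀, 0) c}
  rotation c := X.placedAngle c.1
  Glued e e' := X.PlacedGlued (e.1.1, e.2) (e'.1.1, e'.2)

end PeriodicPolyhedralSurface

/-! ### The five polyhedral surfaces -/

/-- The point with coordinate `x` on the axis `a` and coordinates `y`, `z` on the next two axes in
the cyclic order. -/
def axisPoint (a : Fin 3) (x y z : ℤ) : Fin 3 → ℤ :=
  fun b => if b = a then x else if b = a + 1 then y else z

/-- The sign vectors with product `1`. They point to the vertices of a regular
tetrahedron; coordinatewise multiplication by one of them is a rotation. -/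
def tetraSign : Fin 4 → (Fin 3 → ℤ) :=
  ![![1, 1, 1], ![1, -1, -1], ![-1, 1, -1], ![-1, -1, 1]]

/-- The corners of the square `[0, 1]²`, counterclockwise. -/
def unitSquare : Fin 4 → ℤ × ℤ := ![(0, 0), (1, 0), (1, 1), (0, 1)]

/-- The faces of Mucube: for each axis `a`, the four lateral faces of the square prism
(a unit cube) that is attached to the cube `[0, 1]³` at its face where coordinate `a` is `1`. -/
def mucubeVertex (f : Fin 3 × Fin 4) : Fin 4 → (Fin 3 → ℤ) :=
  ![axisPoint f.1 1 (unitSquare f.2).1 (unitSquare f.2).2,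
    axisPoint f.1 1 (unitSquare (f.2 + 1)).1 (unitSquare (f.2 + 1)).2,
    axisPoint f.1 2 (unitSquare (f.2 + 1)).1 (unitSquare (f.2 + 1)).2,
    axisPoint f.1 2 (unitSquare f.2).1 (unitSquare f.2).2]

/-- Mucube `{4, 6}`: cubes at the points of a cubic lattice, joined along the six directions of the
coordinate axes by square prisms; the surface is the boundary of this solid. -/
def mucube : PeriodicPolyhedralSurface 4 where
  Face := Fin 3 × Fin 4
  vertex f i a := (mucubeVertex f i a : ℝ)
  period := ![![2, 0, 0], ![0, 2, 0], ![0, 0, 2]]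

/-- The hexagonal face in the direction `(1, 1, 1)` of the truncated octahedron whose vertices are
the permutations of `(0, ±1, ±2)`. -/
def hexagon : Fin 6 → (Fin 3 → ℤ) :=
  ![![0, 1, 2], ![1, 0, 2], ![2, 0, 1], ![2, 1, 0], ![1, 2, 0], ![0, 2, 1]]

/-- The eight hexagonal faces of the truncated octahedron: those in the directions `tetraSign d`
and those in the opposite directions. -/
def muoctahedronVertex (f : Fin 4 ⊕ Fin 4) (i : Fin 6) : Fin 3 → ℤ :=
  match f with
  | Sum.inl d => tetraSign d * hexagon i
  | Sum.inr d => -(tetraSign d * hexagon (-i))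

/-- Muoctahedron `{6, 4}`: truncated octahedra at the points of a cubic lattice, glued along their
square faces; the surface consists of the hexagonal faces. -/
def muoctahedron : PeriodicPolyhedralSurface 6 where
  Face := Fin 4 ⊕ Fin 4
  vertex f i a := (muoctahedronVertex f i a : ℝ)
  period := ![![4, 0, 0], ![0, 4, 0], ![0, 0, 4]]

/-- The hexagonal face in the direction `(-1, -1, -1)` of the tetrahedron with the vertices
`3 * tetraSign d`, truncated at a third of the edges. -/
def truncatedHexagon : Fin 6 → (Fin 3 → ℤ) :=
  ![![1, -3, -1], ![-1, -3, 1], ![-3, -1, 1], ![-3, 1, -1], ![-1, 1, -3], ![1, -1, -3]]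

/-- Mutetrahedron `{6, 6}`: truncated tetrahedra, glued along all their triangular faces to regular
tetrahedra, in the pattern of the diamond net; the surface consists of the hexagonal faces of the
truncated tetrahedra. -/
def mutetrahedron : PeriodicPolyhedralSurface 6 where
  Face := Fin 4
  vertex d i a := ((tetraSign d * truncatedHexagon i) a : ℝ)
  period := ![![0, 4, 4], ![4, 0, 4], ![4, 4, 0]]

/-- The point `x` on the axis `i`. -/
def onAxis (x : ℤ) (i : Fin 3) : Fin 3 → ℤ := Pi.single i x

/-- The vertex on the axis `i` of the face in the direction `tetraSign d` of the octahedron with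
vertices `±3` on the axes. -/
def octaLow (d : Fin 4) (i : Fin 3) : Fin 3 → ℤ := tetraSign d * onAxis 3 i

/-- The vertex on the far triangle, opposite to `octaLow d i`, of the triangular antiprism
(a regular octahedron) that is attached to the face `octaLow d`. -/
def octaHigh (d : Fin 4) (i : Fin 3) : Fin 3 → ℤ := (fun a => 4 * tetraSign d a) - octaLow d i

/-- The faces of Octa-4. First, for each `d`, the six lateral triangles of the antiprism that joins
the octahedron centred at `0` to the one centred at `4 * tetraSign d`; then the four free faces of
the octahedron centred at `0`, in the directions `-tetraSign d`, and the four free faces of the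
octahedron centred at `(4, 4, 4)`, in the directions `tetraSign d`. -/
def octa4Vertex (f : (Fin 4 × Fin 3 ⊕ Fin 4 × Fin 3) ⊕ (Fin 4 ⊕ Fin 4)) :
    Fin 3 → (Fin 3 → ℤ) :=
  match f with
  | Sum.inl (Sum.inl (d, k)) => ![octaLow d (k + 1), octaLow d (k + 2), octaHigh d k]
  | Sum.inl (Sum.inr (d, k)) => ![octaHigh d (k + 2), octaHigh d (k + 1), octaLow d k]
  | Sum.inr (Sum.inl d) => fun i => -octaLow d (-i)
  | Sum.inr (Sum.inr d) => fun i => ![4, 4, 4] + octaLow d i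

/-- Octa-4 `{3, 8}`: octahedra at the vertices of the diamond net, joined along its edges by
triangular antiprisms; the surface is the boundary of this solid. -/
def octa4 : PeriodicPolyhedralSurface 3 where
  Face := (Fin 4 × Fin 3 ⊕ Fin 4 × Fin 3) ⊕ (Fin 4 ⊕ Fin 4)
  vertex f i a := (octa4Vertex f i a : ℝ)
  period := ![![0, 8, 8], ![8, 0, 8], ![8, 8, 0]]

/-- The corners of the square with vertices `(±1, 0)`, `(0, ±1)`, counterclockwise. -/
def diagonalSquare : Fin 4 → ℤ × ℤ := ![(1, 0), (0, 1), (-1, 0), (0, -1)]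

/-- The faces of Truncated Octa-8. First the square faces of the truncated octahedron, on the
positive and on the negative side of each axis; then, for each `d`, the six lateral squares of the
hexagonal prism that is attached to its hexagonal face in the direction `tetraSign d`. A vertex is
given by a pair `(u, w)` of integral vectors that stands for `u + √(2/3) * w`: the
prism has the edges `√(2/3) * tetraSign d`, of length `√2`. -/
def truncatedOcta8Vertex (f : (Fin 3 ⊕ Fin 3) ⊕ Fin 4 × Fin 6) :
    Fin 4 → (Fin 3 → ℤ) × (Fin 3 → ℤ) :=
  match f with
  | Sum.inl (Sum.inl a) => fun i =>
      (axisPoint a 2 (diagonalSquare i).1 (diagonalSquare i).2, 0)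
  | Sum.inl (Sum.inr a) => fun i =>
      (axisPoint a (-2) (diagonalSquare (-i)).1 (diagonalSquare (-i)).2, 0)
  | Sum.inr (d, k) =>
      ![(tetraSign d * hexagon k, 0), (tetraSign d * hexagon (k + 1), 0),
        (tetraSign d * hexagon (k + 1), tetraSign d), (tetraSign d * hexagon k, tetraSign d)]

/-- Truncated Octa-8 `{4, 5}`: truncated octahedra at the points of a body-centred cubic lattice,
joined along the eight directions of the diagonals by hexagonal prisms; the surface is the boundary
of this solid. -/
def truncatedOcta8 : PeriodicPolyhedralSurface 4 where
  Face := (Fin 3 ⊕ Fin 3) ⊕ Fin 4 × Fin 6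
  vertex f i a := ((truncatedOcta8Vertex f i).1 a : ℝ) +
    Real.sqrt (2 / 3) * ((truncatedOcta8Vertex f i).2 a : ℝ)
  period := fun b => (2 + Real.sqrt (2 / 3)) • ![![-1, 1, 1], ![1, -1, 1], ![1, 1, -1]] b

end

/-!
Number the oriented edges of a surface by the elements of a finite group, in such a way that the
next edge of a face and the same edge seen from the neighbouring face are found by multiplying by
two fixed elements on the right. This maps the translation cover to a surface tiled by squares,
affinely on each face: an affine map sends a square face to the unit square, a pair of triangles to
a parallelogram, and a hexagon to three rhombi. The squares are permuted by the steps `h` to the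
right and `v` upwards, and two of them have the same lower left corner only if they lie in one cycle
of the commutator `v * h * v⁻¹ * h⁻¹`.

The holonomy of a saddle connection becomes an integral vector. Replacing `(h, v)` by another basis
of the lattice, as Euclid's algorithm does, makes this vector horizontal, so that the saddle
connection runs along the lower side of a square `q`, or of `q` and `h q` if their common corner is
not singular. If the saddle connection is closed, then `h q`, or `h (h q)`, lies in the cycle
of `q`. Every basis arises by shears and quarter turns, and a property of the pair `(h, v)` that is
preserved by both excludes this.
-/

noncomputable section

open Set Equiv Filter Topology

/-! ### Straight paths on surfaces covered by unit squares -/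

theorem eventually_affine_nonneg_or_nonpos (u w : ℝ) :
    (∀ᶠ s in 𝓝[≥] (0 : ℝ), 0 ≤ u + s * w) ∨ ∀ᶠ s in 𝓝[≥] (0 : ℝ), u + s * w ≤ 0 := by
  have htendsto : Tendsto (fun s => u + s * w) (𝓝[≥] 0) (𝓝 u) := by
    have hcont : Continuous fun s : ℝ => u + s * w := by fun_prop
    simpa using (hcont.tendsto 0).mono_left nhdsWithin_le_nhds
  rcases lt_trichotomy u 0 with hu | rfl | hu
  · exact Or.inr (htendsto.eventually_le_const hu)
  · refine (le_total 0 w).imp (fun hw => ?_) fun hw => ?_ <;>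
      filter_upwards [self_mem_nhdsWithin] with s hs
    · simpa only [zero_add] using mul_nonneg hs hw
    · simpa only [zero_add] using mul_nonpos_of_nonneg_of_nonpos hs hw
  · exact Or.inl (htendsto.eventually_const_le hu)

theorem interval_induction {motive : ℝ → Prop} {a b : ℝ} (hab : a ≤ b) (start : motive a)
    (right : ∀ t ∈ Ico a b, motive t → ∀ᶠ s in 𝓝[>] (0 : ℝ), motive (t + s))
    (left : ∀ t ∈ Ioc a b, (∀ᶠ s in 𝓝[>] (0 : ℝ), motive (t - s)) → motive t) : motive b := by
  let S : Set ℝ := {t | ∀ u ∈ Icc a t, motive u}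
  have closed : IsClosed (S ∩ Icc a b) := by
    refine isClosed_of_closure_subset fun t ht => ?_
    have htab : t ∈ Icc a b := closure_minimal inter_subset_right isClosed_Icc ht
    have below : ∀ u ∈ Ico a t, motive u := fun u hu => by
      obtain ⟨t', ht', hS, -⟩ := mem_closure_iff.1 ht (Ioi u) isOpen_Ioi hu.2
      exact hS u ⟨hu.1, le_of_lt ht'⟩
    refine ⟨fun u hu => ?_, htab⟩
    rcases hu.2.lt_or_eq with hut | rfl
    · exact below u ⟨hu.1, hut⟩
    rcases hu.1.eq_or_lt with rfl | hau
    · exact start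
    refine left u ⟨hau, htab.2⟩ ?_
    filter_upwards [Ioo_mem_nhdsGT (sub_pos.2 hau)] with s hs
    exact below _ ⟨by linarith [hs.2], by linarith [hs.1]⟩
  have mem : b ∈ S := by
    refine closed.mem_of_ge_of_forall_exists_gt (fun u hu => ?_) hab fun t ⟨htS, ht⟩ => ?_
    · rwa [le_antisymm hu.2 hu.1]
    · obtain ⟨δ, hδ, hsub⟩ := mem_nhdsGT_iff_exists_Ioc_subset.1
        (right t ht (htS t (right_mem_Icc.2 ht.1)))
      refine ⟨t + min δ (b - t), fun u hu => ?_, ?_⟩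
      · rcases le_or_gt u t with hut | hut
        · exact htS u ⟨hu.1, hut⟩
        · have := hsub (show u - t ∈ Ioc 0 δ from
            ⟨sub_pos.2 hut, by linarith [hu.2, min_le_left δ (b - t)]⟩)
          rwa [mem_ofPred_eq, add_sub_cancel] at this
      · have : 0 < min δ (b - t) := lt_min hδ (sub_pos.2 ht.2)
        exact ⟨by linarith, by linarith [min_le_right δ (b - t)]⟩
  exact mem b (right_mem_Icc.2 hab)

/-- The class of `(x, y)` in the torus `ℝ² / ℤ²`. -/
def torusPoint (x y : ℝ) : UnitAddCircle × UnitAddCircle := (x, y)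

theorem torusPoint_add (x y x' y' : ℝ) :
    torusPoint (x + x') (y + y') = torusPoint x y + torusPoint x' y' := rfl

theorem torusPoint_zero : torusPoint 0 0 = 0 := rfl

theorem torusPoint_eq_iff {x y x' y' : ℝ} :
    torusPoint x y = torusPoint x' y' ↔ (∃ m : ℤ, x = x' + m) ∧ ∃ n : ℤ, y = y' + n := by
  have coe_eq_iff (x x' : ℝ) : (x : UnitAddCircle) = x' ↔ ∃ n : ℤ, x = x' + n := by
    rw [← sub_eq_zero, ← AddCircle.coe_sub, AddCircle.coe_eq_zero_iff]
    refine exists_congr fun n => ?_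
    rw [zsmul_eq_mul, mul_one, eq_sub_iff_add_eq', eq_comm]
  rw [torusPoint, torusPoint, Prod.mk.injEq, coe_eq_iff, coe_eq_iff]

/-- A set `N` covered by closed unit squares `cell q`, glued along their sides by translations; the
lower left corners of two squares agree only if the squares are in the same cycle of `c`. The map
`pos` is the branched cover of the torus `ℝ² / ℤ²` that takes each square to the unit square. -/
structure SquareChart (N : Type*) {Q : Type*} (c : Perm Q) where
  cell : Q → ℝ → ℝ → N
  right : Perm Q
  up : Perm Q
  pos : N → UnitAddCircle × UnitAddCircle
  cell_right : ∀ q, ∀ y ∈ Icc (0 : ℝ) 1, cell q 1 y = cell (right q) 0 y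
  cell_up : ∀ q, ∀ x ∈ Icc (0 : ℝ) 1, cell q x 1 = cell (up q) x 0
  pos_cell : ∀ q, ∀ x ∈ Icc (0 : ℝ) 1, ∀ y ∈ Icc (0 : ℝ) 1, pos (cell q x y) = torusPoint x y
  cell_injective : ∀ q q', ∀ x ∈ Ico (0 : ℝ) 1, ∀ y ∈ Ico (0 : ℝ) 1, x ≠ 0 ∨ y ≠ 0 →
    cell q x y = cell q' x y → q = q'
  corner : ∀ q q', cell q 0 0 = cell q' 0 0 → c.SameCycle q q'

namespace SquareChart

variable {N Q : Type*} {c : Perm Q} (C : SquareChart N c)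

/-- A path whose initial piece is straight of velocity `(a, b)` inside one of the squares. -/
def Ray (γ : ℝ → N) (a b : ℝ) : Prop :=
  ∃ (q : Q) (x y : ℝ), ∀ᶠ s in 𝓝[≥] (0 : ℝ),
    x + s * a ∈ Icc (0 : ℝ) 1 ∧ y + s * b ∈ Icc (0 : ℝ) 1 ∧ γ s = C.cell q (x + s * a) (y + s * b)

/-- A path that on `[0, 1]` is straight of velocity `(a, b)`: the piece after each point and,
run through backwards, the piece before each point are rays. -/
def Straight (γ : ℝ → N) (a b : ℝ) : Prop :=
  (∀ t ∈ Ico (0 : ℝ) 1, C.Ray (fun s => γ (t + s)) a b) ∧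
    ∀ t ∈ Ioc (0 : ℝ) 1, C.Ray (fun s => γ (t - s)) (-a) (-b)

theorem pos_cell_zero (q : Q) : C.pos (C.cell q 0 0) = 0 := by
  rw [C.pos_cell q 0 (by simp) 0 (by simp), torusPoint_zero]

theorem cell_right_symm (q : Q) {y : ℝ} (hy : y ∈ Icc (0 : ℝ) 1) :
    C.cell (C.right.symm q) 1 y = C.cell q 0 y := by
  rw [C.cell_right _ y hy, Equiv.apply_symm_apply]

variable {C} {γ : ℝ → N} {a b : ℝ}

theorem Ray.eventually_pos_eq (h : C.Ray γ a b) :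
    ∀ᶠ s in 𝓝[≥] (0 : ℝ), C.pos (γ s) = C.pos (γ 0) + torusPoint (s * a) (s * b) := by
  obtain ⟨q, x, y, h⟩ := h
  obtain ⟨hx₀, hy₀, h₀⟩ := h.self_of_nhdsWithin self_mem_Ici
  simp only [zero_mul, add_zero] at hx₀ hy₀ h₀
  filter_upwards [h] with s ⟨hx, hy, hs⟩
  rw [hs, h₀, C.pos_cell q _ hx _ hy, C.pos_cell q x hx₀ y hy₀, torusPoint_add]

theorem Straight.pos_eq (h : C.Straight γ a b) {u v : ℝ} (hu : 0 ≤ u) (huv : u ≤ v) (hv : v ≤ 1) :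
    C.pos (γ v) = C.pos (γ u) + torusPoint ((v - u) * a) ((v - u) * b) := by
  refine interval_induction (motive := fun t =>
    C.pos (γ t) = C.pos (γ u) + torusPoint ((t - u) * a) ((t - u) * b)) huv ?_
    (fun t ht ih => ?_) fun t ht ih => ?_
  · simp only [sub_self, zero_mul, torusPoint_zero, add_zero]
  · have hray := h.1 t ⟨hu.trans ht.1, ht.2.trans_le hv⟩
    filter_upwards [hray.eventually_pos_eq.filter_mono (nhdsWithin_mono _ Ioi_subset_Ici_self)]
      with s hs
    rw [hs, add_zero, ih, add_assoc, ← torusPoint_add]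
    ring_nf
  · have hray := h.2 t ⟨hu.trans_lt ht.1, ht.2.trans hv⟩
    obtain ⟨s, hs, hts⟩ :=
      ((hray.eventually_pos_eq.filter_mono (nhdsWithin_mono _ Ioi_subset_Ici_self)).and ih).exists
    refine add_right_cancel (b := torusPoint (s * -a) (s * -b)) ?_
    rw [← sub_zero t, ← hs, hts, add_assoc, ← torusPoint_add]
    ring_nf

theorem eq_zero_or_one_of_intCast {x : ℝ} {n : ℤ} (hx : x ∈ Icc (0 : ℝ) 1) (h : x = n) :
    x = 0 ∨ x = 1 := by
  subst h
  have h0 : 0 ≤ n := mod_cast hx.1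
  have h1 : n ≤ 1 := mod_cast hx.2
  interval_cases n <;> simp

theorem Ray.exists_bottom {t : ℝ} (h : C.Ray γ a 0) (ha : a ≠ 0)
    (hpos : C.pos (γ 0) = torusPoint t 0)
    (ht : ∀ᶠ s in 𝓝[≥] (0 : ℝ), t + s * a ∈ Icc (0 : ℝ) 1) :
    ∃ q, ∀ᶠ s in 𝓝[≥] (0 : ℝ), γ s = C.cell q (t + s * a) 0 := by
  obtain ⟨q, x, y, h⟩ := h
  simp only [mul_zero, add_zero] at h
  obtain ⟨hx₀, hy, h₀⟩ := h.self_of_nhdsWithin self_mem_Ici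
  have ht₀ := ht.self_of_nhdsWithin self_mem_Ici
  simp only [zero_mul, add_zero] at hx₀ h₀ ht₀
  rw [h₀, C.pos_cell q x hx₀ y hy, torusPoint_eq_iff] at hpos
  obtain ⟨⟨m, hm⟩, n, hn⟩ := hpos
  obtain rfl : x = t := by
    obtain ⟨s, ⟨⟨hx, -⟩, ht⟩, hs⟩ := (((h.and ht).filter_mono
      (nhdsWithin_mono _ Ioi_subset_Ici_self)).and self_mem_nhdsWithin).exists
    have hsa : s * a ≠ 0 := mul_ne_zero (ne_of_gt hs) ha
    rcases lt_trichotomy m 0 with hm0 | rfl | hm0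
    · have : (m : ℝ) ≤ -1 := mod_cast Int.le_sub_one_of_lt hm0
      exact absurd (by linarith [hx.1, ht.2, hx₀.1, ht₀.2]) hsa
    · simpa using hm
    · have : (1 : ℝ) ≤ m := mod_cast hm0
      exact absurd (by linarith [hx.2, ht.1, hx₀.2, ht₀.1]) hsa
  rcases eq_zero_or_one_of_intCast hy (by simpa using hn) with rfl | rfl
  · exact ⟨q, h.mono fun s hs => hs.2.2⟩
  · exact ⟨C.up q, h.mono fun s hs => hs.2.2.trans (C.cell_up q _ hs.1)⟩

theorem eq_of_bottom_eq {q q' : Q} {x : ℝ} (hx : x ∈ Ioo (0 : ℝ) 1)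
    (h : C.cell q x 0 = C.cell q' x 0) : q = q' :=
  C.cell_injective q q' x ⟨hx.1.le, hx.2⟩ 0 (by simp) (Or.inl hx.1.ne') h

theorem Straight.exists_bottom_ahead (h : C.Straight γ a 0) (ha : 0 < a) {t x : ℝ}
    (ht : t ∈ Ico (0 : ℝ) 1) (hx : x ∈ Ico (0 : ℝ) 1) (hpos : C.pos (γ t) = torusPoint x 0) :
    ∃ q, ∀ᶠ s in 𝓝[≥] (0 : ℝ), γ (t + s) = C.cell q (x + s * a) 0 := by
  refine (h.1 t ht).exists_bottom ha.ne' (by rwa [add_zero]) ?_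
  filter_upwards [Icc_mem_nhdsGE (div_pos (sub_pos.2 hx.2) ha)] with s hs
  have := (le_div_iff₀ ha).1 hs.2
  exact ⟨add_nonneg hx.1 (mul_nonneg hs.1 ha.le), by linarith⟩

theorem Straight.exists_bottom_behind (h : C.Straight γ a 0) (ha : 0 < a) {t x : ℝ}
    (ht : t ∈ Ioc (0 : ℝ) 1) (hx : x ∈ Ioc (0 : ℝ) 1) (hpos : C.pos (γ t) = torusPoint x 0) :
    ∃ q, ∀ᶠ s in 𝓝[≥] (0 : ℝ), γ (t - s) = C.cell q (x - s * a) 0 := by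
  have hray := h.2 t ht
  rw [neg_zero] at hray
  simp only [sub_eq_add_neg x, ← mul_neg]
  refine hray.exists_bottom (neg_ne_zero.2 ha.ne') (by rwa [sub_zero]) ?_
  filter_upwards [Icc_mem_nhdsGE (div_pos hx.1 ha)] with s hs
  have := (le_div_iff₀ ha).1 hs.2
  exact ⟨by linarith, by linarith [hx.2, mul_nonneg hs.1 ha.le]⟩

theorem Straight.eq_cell_of_eventually_eq (h : C.Straight γ a 0) (ha : 0 < a) {u v : ℝ} {q : Q}
    (hu : 0 ≤ u) (huv : u ≤ v) (hv : v ≤ 1) (hva : (v - u) * a ≤ 1) (h0 : C.pos (γ u) = 0)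
    (hq : ∀ᶠ s in 𝓝[≥] (0 : ℝ), γ (u + s) = C.cell q (s * a) 0) :
    γ v = C.cell q ((v - u) * a) 0 := by
  let x : ℝ → ℝ := fun t => (t - u) * a
  have x_add (t s : ℝ) : x (t + s) = x t + s * a := by ring
  have x_sub (t s : ℝ) : x (t - s) = x t - s * a := by ring
  have x_pos {t : ℝ} (ht : u < t) : 0 < x t := mul_pos (sub_pos.2 ht) ha
  have x_lt {t : ℝ} (ht : t < v) : x t < 1 :=
    (mul_lt_mul_of_pos_right (sub_lt_sub_right ht u) ha).trans_le hva
  have hpos (t : ℝ) (ht : t ∈ Icc u v) : C.pos (γ t) = torusPoint (x t) 0 := by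
    simpa [h0] using h.pos_eq hu ht.1 (ht.2.trans hv)
  refine interval_induction (motive := fun t => γ t = C.cell q (x t) 0) huv
    (by simpa [x] using hq.self_of_nhdsWithin self_mem_Ici) (fun t ht ih => ?_) fun t ht ih => ?_
  · simp only [x_add]
    refine Eventually.filter_mono (nhdsWithin_mono _ Ioi_subset_Ici_self) ?_
    rcases ht.1.eq_or_lt with rfl | hut
    · simpa [x] using hq
    · obtain ⟨q', hq'⟩ := h.exists_bottom_ahead ha ⟨hu.trans ht.1, ht.2.trans_le hv⟩
        ⟨(x_pos hut).le, x_lt ht.2⟩ (hpos t ⟨ht.1, ht.2.le⟩)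
      have hqq : q = q' := eq_of_bottom_eq ⟨x_pos hut, x_lt ht.2⟩
        (ih.symm.trans (by simpa using hq'.self_of_nhdsWithin self_mem_Ici))
      rwa [hqq]
  · obtain ⟨q', hq'⟩ := h.exists_bottom_behind ha ⟨hu.trans_lt ht.1, ht.2.trans hv⟩
      ⟨x_pos ht.1, (mul_le_mul_of_nonneg_right (by linarith [ht.2]) ha.le).trans hva⟩
      (hpos t ⟨ht.1.le, ht.2⟩)
    obtain ⟨s, ⟨hs, hs'⟩, hs0, hst⟩ :=
      (((hq'.filter_mono (nhdsWithin_mono _ Ioi_subset_Ici_self)).and ih).and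
        (Ioo_mem_nhdsGT (sub_pos.2 ht.1))).exists
    have hqq : q = q' := eq_of_bottom_eq ⟨x_pos (by linarith), x_lt (by linarith [ht.2])⟩
      (hs'.symm.trans (hs.trans (by rw [x_sub])))
    simpa [hqq] using hq'.self_of_nhdsWithin self_mem_Ici

theorem Straight.exists_side (h : C.Straight γ a 0) {u v : ℝ} (hu : 0 ≤ u) (huv : u < v)
    (hv : v ≤ 1) (hva : (v - u) * a = 1) (h0 : C.pos (γ u) = 0) :
    ∃ q, γ u = C.cell q 0 0 ∧ γ v = C.cell (C.right q) 0 0 := by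
  have ha : 0 < a := pos_of_mul_pos_right (hva ▸ one_pos) (sub_pos.2 huv).le
  obtain ⟨q, hq⟩ := h.exists_bottom_ahead ha ⟨hu, huv.trans_le hv⟩ (x := 0) (by simp) h0
  simp only [zero_add] at hq
  refine ⟨q, by simpa using hq.self_of_nhdsWithin self_mem_Ici, ?_⟩
  rw [h.eq_cell_of_eventually_eq ha hu huv.le hv hva.le h0 hq, hva, C.cell_right q 0 (by simp)]

theorem Straight.exists_intCast_of_pos_eq (h : C.Straight γ a b) (hγ : C.pos (γ 0) = C.pos (γ 1)) :
    ∃ m n : ℤ, a = m ∧ b = n := by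
  have key := h.pos_eq le_rfl zero_le_one le_rfl
  rw [← hγ, left_eq_add, ← torusPoint_zero, torusPoint_eq_iff] at key
  obtain ⟨⟨m, hm⟩, n, hn⟩ := key
  exact ⟨m, n, by simpa using hm, by simpa using hn⟩

end SquareChart

/-- The first return condition on the lower left corners of squares: a step to the right from a
square in `S` (or two steps, when the first one leaves `S`) leads to a square in `S` that is not in
the same cycle of `c`. -/
def NoReturn {Q : Type*} (c : Perm Q) (S : Set Q) (h : Perm Q) : Prop :=
  ∀ q ∈ S, (h q ∈ S → ¬ c.SameCycle q (h q)) ∧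
    (h q ∉ S → h (h q) ∈ S ∧ ¬ c.SameCycle q (h (h q)))

theorem mem_of_sameCycle {Q : Type*} {c : Perm Q} {S : Set Q} (hS : ∀ q ∉ S, c q = q) {q q' : Q}
    (h : c.SameCycle q q') (hq : q ∈ S) : q' ∈ S := by
  by_contra hq'
  exact hq' (h.eq_of_right (hS q' hq') ▸ hq)

namespace SquareChart

variable {N Q : Type*} {c : Perm Q} {C : SquareChart N c} {γ : ℝ → N} {S : Set Q}

theorem Straight.exists_side_nat {k j : ℕ} (h : C.Straight γ k 0) (hj : j < k)
    (h0 : C.pos (γ (j / k)) = 0) :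
    ∃ q, γ (j / k) = C.cell q 0 0 ∧ γ ((j + 1 : ℕ) / k) = C.cell (C.right q) 0 0 := by
  have hk : (0 : ℝ) < k := mod_cast j.zero_le.trans_lt hj
  refine h.exists_side (by positivity) (by gcongr; simp) ?_ ?_ h0
  · exact (div_le_one hk).2 (mod_cast hj)
  · push_cast
    field_simp
    ring

theorem Straight.ne_of_noReturn {k : ℕ} (h : C.Straight γ k 0) (hk : 0 < k)
    (hS : ∀ q ∉ S, c q = q) (hret : NoReturn c S C.right) (hγ0 : ∃ q ∈ S, γ 0 = C.cell q 0 0)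
    (hγ : ∀ t ∈ Ioo (0 : ℝ) 1, ∀ q ∈ S, γ t ≠ C.cell q 0 0) : γ 0 ≠ γ 1 := by
  intro hclosed
  obtain ⟨q₀, hq₀, e₀⟩ := hγ0
  have hk' : (0 : ℝ) < k := mod_cast hk
  have last {j : ℕ} {q : Q} (hj0 : 0 < j) (hj : j ≤ k) (hq : q ∈ S)
      (e : γ (j / k) = C.cell q 0 0) : γ 0 = C.cell q 0 0 := by
    obtain rfl : j = k := by
      refine hj.eq_of_not_lt fun hjk => hγ (j / k) ⟨by positivity, ?_⟩ q hq e
      exact (div_lt_one hk').2 (mod_cast hjk)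
    rwa [hclosed, ← div_self hk'.ne']
  obtain ⟨q, e, e₁⟩ := h.exists_side_nat hk (by simp [e₀, C.pos_cell_zero])
  rw [Nat.cast_zero, zero_div] at e
  have hq : q ∈ S := mem_of_sameCycle hS (C.corner _ _ (e₀.symm.trans e)) hq₀
  obtain ⟨ret₁, ret₂⟩ := hret q hq
  by_cases hS₁ : C.right q ∈ S
  · exact ret₁ hS₁ (C.corner _ _ (e.symm.trans (last one_pos hk hS₁ e₁)))
  obtain ⟨hS₂, ret₂⟩ := ret₂ hS₁
  have hk₁ : 1 < k := by
    refine lt_of_le_of_ne hk fun hk₁ => hS₁ (mem_of_sameCycle hS (C.corner _ _ ?_) hq)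
    rw [← e, hclosed, ← e₁, ← hk₁]
    simp
  obtain ⟨q', e', e₂⟩ := h.exists_side_nat hk₁ (by rw [e₁, C.pos_cell_zero])
  obtain rfl : C.right q = q' := (C.corner _ _ (e₁.symm.trans e')).eq_of_left (hS _ hS₁)
  exact ret₂ (C.corner _ _ (e.symm.trans (last two_pos hk₁ hS₂ e₂)))

end SquareChart

/-! ### Changes of the lattice basis -/

theorem euclidean_induction {motive : ℤ → ℤ → Prop} (horizontal : ∀ m : ℕ, 0 < m → motive m 0)
    (shear : ∀ a b, motive (a - b) b → motive a b) (turn : ∀ a b, motive b (-a) → motive a b)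
    (a b : ℤ) (hab : a ≠ 0 ∨ b ≠ 0) : motive a b := by
  have horizontal' {a : ℤ} (ha : 0 < a) : motive a 0 := by
    lift a to ℕ using ha.le
    exact horizontal a (mod_cast ha)
  have nonneg (n : ℕ) : ∀ a b : ℤ, 0 ≤ a → 0 ≤ b → a ≠ 0 ∨ b ≠ 0 → a + b ≤ n → motive a b := by
    induction n with
    | zero => lia
    | succ n ih =>
      intro a b ha hb hab hn
      rcases hb.eq_or_lt with rfl | hb
      · exact horizontal' (by lia)
      rcases ha.eq_or_lt with rfl | ha
      · exact turn 0 b (by simpa using horizontal' hb)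
      rcases le_total b a with hba | hab
      · exact shear a b (ih _ _ (by lia) hb.le (by lia) (by lia))
      · -- A shear, a quarter turn and a shear take `(a, b)` to `(a, b - a)`.
        refine shear a b (turn _ _ (shear _ _ ?_))
        convert ih a (b - a) ha.le (by lia) (by lia) (by lia) using 1 <;> ring
  have nonneg {a b : ℤ} (ha : 0 ≤ a) (hb : 0 ≤ b) (hab : a ≠ 0 ∨ b ≠ 0) : motive a b :=
    nonneg (a + b).toNat a b ha hb hab (by lia)
  rcases le_total 0 a with ha | ha <;> rcases le_total 0 b with hb | hb
  · exact nonneg ha hb hab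
  · exact turn _ _ (turn _ _ (turn _ _ (nonneg (by lia) (by lia) (by lia))))
  · exact turn _ _ (nonneg (by lia) (by lia) (by lia))
  · exact turn _ _ (turn _ _ (nonneg (by lia) (by lia) (by lia)))

/-- A property of the gluing permutations `(h, v)` (to the right, upwards) of a square-tiled surface
that is preserved by the changes of the lattice basis from `(e, f)` to `(e, e + f)` and
to `(f, -e)`, which generate all changes that preserve the orientation. -/
structure MoveInvariant {Q : Type*} (P : Perm Q → Perm Q → Prop) : Prop where
  shear : ∀ h v, P h v → P h (v * h)
  quarterTurn : ∀ h v, P h v → P (h * v * h⁻¹) h⁻¹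

namespace SquareChart

variable {N Q : Type*} {c : Perm Q} (C : SquareChart N c)

/-- The chart for the lattice basis `(e, e + f)` in place of `(e, f)`. -/
def shear : SquareChart N c where
  cell q x y := if x + y ≤ 1 then C.cell q (x + y) y else C.cell (C.right q) (x + y - 1) y
  right := C.right
  up := C.up * C.right
  pos P := ((C.pos P).1 - (C.pos P).2, (C.pos P).2)
  cell_right q y hy := by
    rw [if_pos (by linarith [hy.2] : (0 : ℝ) + y ≤ 1), zero_add, add_sub_cancel_left]
    split_ifs with h
    · obtain rfl : y = 0 := le_antisymm (by linarith) hy.1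
      rw [add_zero, C.cell_right q 0 hy]
    · rfl
  cell_up q x hx := by
    rw [if_pos (by linarith [hx.2] : x + (0 : ℝ) ≤ 1), Perm.mul_apply, add_zero,
      add_sub_cancel_right]
    split_ifs with h
    · obtain rfl : x = 0 := le_antisymm (by linarith) hx.1
      rw [zero_add, C.cell_right q 1 (by simp), C.cell_up _ 0 hx]
    · rw [C.cell_up _ x hx]
  pos_cell q x hx y hy := by
    split_ifs with h
    · rw [C.pos_cell _ _ ⟨by linarith [hx.1, hy.1], h⟩ _ hy]
      simp [torusPoint]
    · rw [C.pos_cell _ _ ⟨by linarith, by linarith [hx.2, hy.2]⟩ _ hy]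
      simp [torusPoint, AddCircle.coe_period]
  cell_injective q q' x hx y hy h0 h := by
    split_ifs at h with h1
    · rcases h1.lt_or_eq with h2 | h2
      · refine C.cell_injective q q' _ ⟨add_nonneg hx.1 hy.1, h2⟩ y hy ?_ h
        by_contra! h3
        exact h0.elim (fun hx0 => hx0 (by linarith)) fun hy0 => hy0 h3.2
      · rw [h2, C.cell_right _ y ⟨hy.1, hy.2.le⟩, C.cell_right _ y ⟨hy.1, hy.2.le⟩] at h
        refine C.right.injective (C.cell_injective _ _ 0 (by simp) y hy (Or.inr ?_) h)
        rintro rfl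
        linarith [hx.2]
    · exact C.right.injective (C.cell_injective _ _ (x + y - 1)
        ⟨by linarith, by linarith [hx.2, hy.2]⟩ y hy (Or.inl (by linarith)) h)
  corner q q' h := by
    simp only [add_zero, zero_le_one, if_true] at h
    exact C.corner q q' h

/-- The chart for the lattice basis `(f, -e)` in place of `(e, f)`. -/
def quarterTurn : SquareChart N c where
  cell q x y := C.cell (C.right.symm q) (1 - y) x
  right := C.right * C.up * C.right⁻¹
  up := C.right⁻¹
  pos P := ((C.pos P).2, -(C.pos P).1)
  cell_right q y hy := by
    rw [C.cell_up _ _ ⟨by linarith [hy.2], by linarith [hy.1]⟩]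
    simp
  cell_up q x hx := by
    rw [sub_self, sub_zero, C.cell_right_symm _ hx]
    rfl
  pos_cell q x hx y hy := by
    rw [C.pos_cell _ _ ⟨by linarith [hy.2], by linarith [hy.1]⟩ _ hx]
    simp [torusPoint, AddCircle.coe_period]
  cell_injective q q' x hx y hy h0 h := by
    rcases hy.1.eq_or_lt with rfl | hy0
    · rw [sub_zero, C.cell_right_symm _ ⟨hx.1, hx.2.le⟩, C.cell_right_symm _ ⟨hx.1, hx.2.le⟩] at h
      exact C.cell_injective q q' 0 (by simp) x hx (Or.inr (h0.resolve_right (by simp))) h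
    · exact C.right.symm.injective (C.cell_injective _ _ (1 - y)
        ⟨by linarith [hy.2], by linarith⟩ x hx (Or.inl (by linarith [hy.2])) h)
  corner q q' h := by
    rw [sub_zero, C.cell_right_symm _ (by simp), C.cell_right_symm _ (by simp)] at h
    exact C.corner q q' h

theorem shear_cell_zero (q : Q) : C.shear.cell q 0 0 = C.cell q 0 0 := by
  simp [shear]

theorem quarterTurn_cell_zero (q : Q) : C.quarterTurn.cell q 0 0 = C.cell q 0 0 := by
  simp [quarterTurn, C.cell_right_symm q (y := 0) (by simp)]

variable {C} {γ : ℝ → N} {a b : ℝ}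

theorem Ray.shear (h : C.Ray γ a b) : C.shear.Ray γ (a - b) b := by
  obtain ⟨q, x, y, h⟩ := h
  rcases eventually_affine_nonneg_or_nonpos (x - y) (a - b) with hxy | hxy
  · refine ⟨q, x - y, y, ?_⟩
    filter_upwards [h, hxy] with s ⟨hx, hy, e⟩ hs
    refine ⟨⟨hs, by linarith [hx.2, hy.1]⟩, hy, ?_⟩
    have hadd : x - y + s * (a - b) + (y + s * b) = x + s * a := by ring
    simp only [SquareChart.shear, hadd]
    rw [e, if_pos hx.2]
  · refine ⟨C.right.symm q, x - y + 1, y, ?_⟩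
    filter_upwards [h, hxy] with s ⟨hx, hy, e⟩ hs
    refine ⟨⟨by linarith [hx.1, hy.2], by linarith⟩, hy, ?_⟩
    have hadd : x - y + 1 + s * (a - b) + (y + s * b) = x + s * a + 1 := by ring
    simp only [SquareChart.shear, hadd, Equiv.apply_symm_apply, add_sub_cancel_right]
    split_ifs with hle
    · rw [e, le_antisymm (by linarith) hx.1, zero_add, C.cell_right_symm _ hy]
    · exact e

theorem Ray.quarterTurn (h : C.Ray γ a b) : C.quarterTurn.Ray γ b (-a) := by
  obtain ⟨q, x, y, h⟩ := h
  refine ⟨C.right q, y, 1 - x, ?_⟩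
  filter_upwards [h] with s ⟨hx, hy, e⟩
  refine ⟨hy, ⟨by linarith [hx.2], by linarith [hx.1]⟩, ?_⟩
  have hsub : 1 - (1 - x + s * -a) = x + s * a := by ring
  simpa only [SquareChart.quarterTurn, hsub, Equiv.symm_apply_apply] using e

theorem Straight.shear (h : C.Straight γ a b) : C.shear.Straight γ (a - b) b :=
  ⟨fun t ht => (h.1 t ht).shear, fun t ht => by
    have := (h.2 t ht).shear
    rwa [neg_sub_neg, ← neg_sub] at this⟩

theorem Straight.quarterTurn (h : C.Straight γ a b) : C.quarterTurn.Straight γ b (-a) :=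
  ⟨fun t ht => (h.1 t ht).quarterTurn, fun t ht => (h.2 t ht).quarterTurn⟩

theorem exists_horizontal {P : Perm Q → Perm Q → Prop} (hP : MoveInvariant P) {a b : ℤ}
    (hab : a ≠ 0 ∨ b ≠ 0) (C : SquareChart N c) (hC : P C.right C.up) (h : C.Straight γ a b) :
    ∃ C' : SquareChart N c, P C'.right C'.up ∧ (∀ q, C'.cell q 0 0 = C.cell q 0 0) ∧
      ∃ k : ℕ, 0 < k ∧ C'.Straight γ k 0 := by
  refine euclidean_induction (motive := fun a b => ∀ C : SquareChart N c, P C.right C.up →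
    C.Straight γ a b → ∃ C' : SquareChart N c, P C'.right C'.up ∧
      (∀ q, C'.cell q 0 0 = C.cell q 0 0) ∧ ∃ k : ℕ, 0 < k ∧ C'.Straight γ k 0)
    ?_ ?_ ?_ a b hab C hC h
  · exact fun k hk C hC h => ⟨C, hC, fun _ => rfl, k, hk, by simpa using h⟩
  · intro a b ih C hC h
    obtain ⟨C', hC', hcell, h'⟩ := ih C.shear (hP.shear _ _ hC) (by simpa using h.shear)
    exact ⟨C', hC', fun q => (hcell q).trans (C.shear_cell_zero q), h'⟩
  · intro a b ih C hC h
    obtain ⟨C', hC', hcell, h'⟩ :=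
      ih C.quarterTurn (hP.quarterTurn _ _ hC) (by simpa using h.quarterTurn)
    exact ⟨C', hC', fun q => (hcell q).trans (C.quarterTurn_cell_zero q), h'⟩

theorem Straight.ne_of_moveInvariant {P : Perm Q → Perm Q → Prop} (hP : MoveInvariant P) {S : Set Q}
    (hS : ∀ q ∉ S, c q = q) (hret : ∀ h v, P h v → NoReturn c S h) (hC : P C.right C.up)
    (hab : a ≠ 0 ∨ b ≠ 0) (h : C.Straight γ a b) (hγ0 : ∃ q ∈ S, γ 0 = C.cell q 0 0)
    (hγ : ∀ t ∈ Ioo (0 : ℝ) 1, ∀ q ∈ S, γ t ≠ C.cell q 0 0) : γ 0 ≠ γ 1 := by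
  intro hclosed
  obtain ⟨m, n, rfl, rfl⟩ := h.exists_intCast_of_pos_eq (congrArg C.pos hclosed)
  obtain ⟨C', hC', hcell, k, hk, h'⟩ := exists_horizontal hP (by simpa using hab) C hC h
  simp only [← hcell] at hγ0 hγ
  exact h'.ne_of_noReturn hk hS (hret _ _ hC') hγ0 hγ hclosed

end SquareChart

/-! ### Square-tiled surfaces with a simply transitive group of translations -/

namespace SquareChart

variable {Q : Type*}

/-- The class of the point `(x, y)` of the unit square numbered `q`, when these squares are glued
along their sides by the permutations `h` and `v`: the set of the numbers that the point has up to
gluing, together with its position in the torus. -/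
def glueCell (h v : Perm Q) (q : Q) (x y : ℝ) : Set Q × UnitAddCircle × UnitAddCircle :=
  let q' := (if y = 1 then v else 1) ((if x = 1 then h else 1) q)
  (if (x = 0 ∨ x = 1) ∧ (y = 0 ∨ y = 1) then {r | (v * h * v⁻¹ * h⁻¹).SameCycle q' r} else {q'},
    torusPoint x y)

theorem glueCell_eq_iff_of_ne_zero {h v : Perm Q} {q q' : Q} {x y : ℝ} (hx : x ∈ Ico (0 : ℝ) 1)
    (hy : y ∈ Ico (0 : ℝ) 1) (h0 : x ≠ 0 ∨ y ≠ 0) :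
    glueCell h v q x y = glueCell h v q' x y ↔ q = q' := by
  have hcorner : ¬(x = 0 ∧ y = 0) := not_and_or.2 h0
  simp [glueCell, hcorner, hx.2.ne, hy.2.ne]

/-- The unit squares numbered by `Q`, glued along their sides by the permutations `h` and `v`. -/
def ofPerms (h v : Perm Q) :
    SquareChart (Set Q × UnitAddCircle × UnitAddCircle) (v * h * v⁻¹ * h⁻¹) where
  cell := glueCell h v
  right := h
  up := v
  pos := Prod.snd
  cell_right q y _ := by
    simp [glueCell, torusPoint, AddCircle.coe_period]
  cell_up q x _ := by
    have key (r : Q) : (v * h * v⁻¹ * h⁻¹).SameCycle (v (h q)) r ↔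
        (v * h * v⁻¹ * h⁻¹).SameCycle (h (v q)) r := by
      rw [← Perm.sameCycle_apply_left (x := h (v q))]
      simp
    by_cases hx : x = 1 <;> simp [glueCell, torusPoint, AddCircle.coe_period, hx, key]
  pos_cell _ _ _ _ _ := rfl
  cell_injective _ _ _ hx _ hy h0 e := (glueCell_eq_iff_of_ne_zero hx hy h0).1 e
  corner q q' e := by
    have hsets : {r | (v * h * v⁻¹ * h⁻¹).SameCycle q r} =
        {r | (v * h * v⁻¹ * h⁻¹).SameCycle q' r} := by
      simpa [glueCell] using congrArg Prod.fst e
    exact (Set.ext_iff.1 hsets q').2 (Perm.SameCycle.refl _ _)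

end SquareChart

variable {G : Type*} [Group G] {a b c₀ g : G}

/-- Right multiplications by two elements with the commutator `a⁻¹ * b⁻¹ * a * b = c₀` that generate
a subgroup containing `g`. -/
def RightMulPair (c₀ g : G) (h v : Perm G) : Prop :=
  ∃ a b : G, h = Equiv.mulRight a ∧ v = Equiv.mulRight b ∧ a⁻¹ * b⁻¹ * a * b = c₀ ∧
    g ∈ Subgroup.closure {a, b}

theorem moveInvariant_rightMulPair (c₀ g : G) : MoveInvariant (RightMulPair c₀ g) where
  shear := by
    rintro _ _ ⟨a, b, rfl, rfl, hc, hg⟩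
    refine ⟨a, a * b, rfl, by ext; simp [mul_assoc], by rw [← hc]; group, ?_⟩
    have ha : a ∈ Subgroup.closure {a, a * b} := Subgroup.subset_closure (by simp)
    have hab : a * b ∈ Subgroup.closure {a, a * b} := Subgroup.subset_closure (by simp)
    refine (Subgroup.closure_le _).2 (pair_subset ha ?_) hg
    simpa using mul_mem (inv_mem ha) hab
  quarterTurn := by
    rintro _ _ ⟨a, b, rfl, rfl, hc, hg⟩
    refine ⟨a⁻¹ * b * a, a⁻¹, by ext; simp [mul_assoc], by ext; simp, by rw [← hc]; group, ?_⟩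
    have hba : a⁻¹ * b * a ∈ Subgroup.closure {a⁻¹ * b * a, a⁻¹} :=
      Subgroup.subset_closure (by simp)
    have ha : a⁻¹ ∈ Subgroup.closure {a⁻¹ * b * a, a⁻¹} := Subgroup.subset_closure (by simp)
    refine (Subgroup.closure_le _).2 (pair_subset (by simpa using inv_mem ha) ?_) hg
    simpa [mul_assoc] using mul_mem (mul_mem (inv_mem ha) hba) ha

theorem mulRight_commutator (a b : G) :
    Equiv.mulRight b * Equiv.mulRight a * (Equiv.mulRight b)⁻¹ * (Equiv.mulRight a)⁻¹ =
      Equiv.mulRight (a⁻¹ * b⁻¹ * a * b) := by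
  ext
  simp [mul_assoc]

theorem inv_mul_mem_zpowers_of_sameCycle {q q' : G} (h : (Equiv.mulRight c₀).SameCycle q q') :
    q⁻¹ * q' ∈ Subgroup.zpowers c₀ := by
  obtain ⟨i, rfl⟩ := h
  exact ⟨i, by simp⟩

theorem noReturn_mulRight (ha : a ∉ Subgroup.zpowers c₀) :
    NoReturn (Equiv.mulRight c₀) univ (Equiv.mulRight a) := by
  refine fun q _ => ⟨fun _ h => ha ?_, fun h => absurd (mem_univ _) h⟩
  simpa using inv_mul_mem_zpowers_of_sameCycle h

theorem zpowers_eq_of_mem_zpowers_of_prime_order (hc : (orderOf c₀).Prime)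
    (ha : a ∈ Subgroup.zpowers c₀) (ha1 : a ≠ 1) : Subgroup.zpowers a = Subgroup.zpowers c₀ := by
  have : Finite (Subgroup.zpowers c₀) := finite_zpowers.2 (orderOf_pos_iff.1 hc.pos)
  refine Subgroup.eq_of_le_of_card_ge (Subgroup.zpowers_le.2 ha) ?_
  rw [Nat.card_zpowers, Nat.card_zpowers,
    (hc.eq_one_or_self_of_dvd _ (orderOf_dvd_of_mem_zpowers ha)).resolve_left
      (mt orderOf_eq_one_iff.1 ha1)]

theorem ne_one_of_commutator (hab : a⁻¹ * b⁻¹ * a * b ≠ 1) : a ≠ 1 := by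
  rintro rfl
  simp at hab

theorem notMem_zpowers_of_order_two (hc : orderOf c₀ = 2) (hab : a⁻¹ * b⁻¹ * a * b = c₀) :
    a ∉ Subgroup.zpowers c₀ := by
  intro ha
  have hc1 : c₀ ≠ 1 := mt orderOf_eq_one_iff.2 (by simp [hc])
  have hc2 : c₀ * c₀ = 1 := by rw [← pow_two, ← hc, pow_orderOf_eq_one]
  have hfin : IsOfFinOrder c₀ := orderOf_pos_iff.1 (by simp [hc])
  classical
  have hac : a = 1 ∨ a = c₀ := by
    rw [hfin.mem_zpowers_iff_mem_range_orderOf, hc] at ha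
    simpa [Finset.range_add_one, eq_comm, or_comm] using ha
  rcases hac with rfl | rfl
  · exact ne_one_of_commutator (hab ▸ hc1) rfl
  · refine hc1 (conj_eq_one_iff (a := b⁻¹).1 ?_)
    calc b⁻¹ * a * b⁻¹⁻¹ = a * (a⁻¹ * b⁻¹ * a * b) := by group
      _ = 1 := by rw [hab, hc2]

theorem notMem_zpowers_of_prime_order (hc : (orderOf c₀).Prime) (hab : a⁻¹ * b⁻¹ * a * b = c₀)
    (hg : g ∈ Subgroup.closure {a, b}) (hgc : g * c₀ * g⁻¹ ∉ Subgroup.zpowers c₀) :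
    a ∉ Subgroup.zpowers c₀ := by
  intro ha
  have : Finite (Subgroup.zpowers c₀) := finite_zpowers.2 (orderOf_pos_iff.1 hc.pos)
  have hca : Subgroup.zpowers a = Subgroup.zpowers c₀ := by
    refine zpowers_eq_of_mem_zpowers_of_prime_order hc ha (ne_one_of_commutator (b := b) ?_)
    exact hab ▸ mt orderOf_eq_one_iff.2 hc.ne_one
  have hb : b⁻¹ ∈ Subgroup.normalizer (Subgroup.zpowers c₀ : Set G) := by
    refine Subgroup.mem_normalizer_fintype fun n hn => ?_
    obtain ⟨i, rfl⟩ := hca ▸ hn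
    have hconj : b⁻¹ * a * b⁻¹⁻¹ = a * c₀ := by rw [← hab]; group
    simp only [← conj_zpow, hconj]
    exact zpow_mem (mul_mem ha (Subgroup.mem_zpowers c₀)) i
  have hclosure : Subgroup.closure {a, b} ≤ Subgroup.normalizer (Subgroup.zpowers c₀ : Set G) :=
    (Subgroup.closure_le _).2 (pair_subset (Subgroup.le_normalizer ha) (by simpa using inv_mem hb))
  exact hgc ((Subgroup.mem_normalizer_iff.1 (hclosure hg) c₀).1 (Subgroup.mem_zpowers c₀))

/-! ### Regular polygons and their straight paths in a square chart -/

/-- The root of unity of order `2 * p` with the smallest positive argument. -/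
def unitRoot (p : ℕ) : ℂ := Complex.exp (Real.pi * Complex.I / p)

theorem regularVertex_eq_unitRoot_pow {p : ℕ} (m : ℕ) (j : Fin p) :
    regularVertex p (Real.pi * m / p) j = unitRoot p ^ (m + 2 * (j : ℕ)) := by
  rw [regularVertex, unitRoot, ← Complex.exp_nat_mul]
  congr 1
  push_cast
  ring

theorem unitRoot_two_mul_pow_two (q : ℕ) : unitRoot (2 * q) ^ 2 = unitRoot q := by
  rw [unitRoot, unitRoot, ← Complex.exp_nat_mul]
  congr 1
  push_cast
  field_simp

theorem unitRoot_two : unitRoot 2 = Complex.I := by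
  have harg : (Real.pi : ℂ) * Complex.I / (2 : ℕ) = Real.pi / 2 * Complex.I := by
    push_cast
    ring
  rw [unitRoot, harg, Complex.exp_pi_div_two_mul_I]

theorem unitRoot_three : unitRoot 3 = ⟨1 / 2, √3 / 2⟩ := by
  have harg : (Real.pi : ℂ) * Complex.I / (3 : ℕ) = ((Real.pi / 3 : ℝ) : ℂ) * Complex.I := by
    push_cast
    ring
  rw [unitRoot, harg]
  apply Complex.ext
  · rw [Complex.exp_ofReal_mul_I_re, Real.cos_pi_div_three]
  · rw [Complex.exp_ofReal_mul_I_im, Real.sin_pi_div_three]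

variable {p : ℕ} [NeZero p]

theorem isPrimitiveRoot_unitRoot : IsPrimitiveRoot (unitRoot p) (2 * p) := by
  have hp : (p : ℂ) ≠ 0 := Nat.cast_ne_zero.2 (NeZero.ne p)
  have harg : (Real.pi : ℂ) * Complex.I / p = 2 * Real.pi * Complex.I / (2 * p : ℕ) := by
    push_cast
    field_simp
  rw [unitRoot, harg]
  exact Complex.isPrimitiveRoot_exp _ (NeZero.ne _)

theorem unitRoot_pow_eq_iff {m n : ℕ} : unitRoot p ^ m = unitRoot p ^ n ↔ m ≡ n [MOD 2 * p] := by
  have hfin : IsOfFinOrder (unitRoot p) :=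
    isPrimitiveRoot_unitRoot.isOfFinOrder (NeZero.ne _)
  rw [hfin.pow_eq_pow_iff_modEq, ← isPrimitiveRoot_unitRoot.eq_orderOf]

theorem unitRoot_pow_self : unitRoot p ^ p = -1 := by
  have hp : (p : ℂ) ≠ 0 := Nat.cast_ne_zero.2 (NeZero.ne p)
  rw [unitRoot, ← Complex.exp_nat_mul, mul_div_cancel₀ _ hp, Complex.exp_pi_mul_I]

theorem val_add_one_modEq (i : Fin p) : ((i + 1 : Fin p) : ℕ) ≡ i + 1 [MOD p] := by
  rw [Fin.val_add]
  exact (Nat.mod_modEq _ _).trans (Nat.ModEq.add_left _ (Nat.mod_modEq 1 p))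

namespace RegularPolygonGluing

variable {S : RegularPolygonGluing p}

theorem polygon_subset {s : Set ℂ} (hs : Convex ℝ s) {f : S.Face} (h : ∀ i, S.vertex f i ∈ s) :
    S.polygon f ⊆ s :=
  convexHull_min (range_subset_iff.2 h) hs

theorem vertex_mem_polygon (f : S.Face) (i : Fin p) : S.vertex f i ∈ S.polygon f :=
  subset_convexHull ℝ _ (mem_range_self i)

theorem IsSingular.corners_nonempty {P : S.Point} (h : S.IsSingular P) :
    (S.corners P).Nonempty := by
  rw [nonempty_iff_ne_empty]
  intro hempty
  rw [IsSingular, vertexAngle, hempty, ncard_empty, Nat.cast_zero, zero_mul] at h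
  linarith [Real.pi_pos]

/-- A development of the polygons of `S` in a set with a square chart that is compatible with the
gluing, takes straight paths to straight paths, and takes the vertices of polygons, and no
other points, to lower left corners of squares in `T`. -/
structure SquareModel (S : RegularPolygonGluing p) {N Q : Type*} {c : Perm Q}
    (C : SquareChart N c) (T : Set Q) where
  develop : S.Face → ℂ → N
  linX : ℂ →ₗ[ℝ] ℝ
  linY : ℂ →ₗ[ℝ] ℝ
  eq_zero_of_lin : ∀ z, linX z = 0 → linY z = 0 → z = 0
  develop_eq : ∀ x y : S.PolygonPoint, S.Identified x y →
    develop x.1.1 x.1.2 = develop y.1.1 y.1.2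
  ray : ∀ f x z, (∀ᶠ s : ℝ in 𝓝[≥] 0, x + (s : ℂ) * z ∈ S.polygon f) →
    C.Ray (fun s => develop f (x + (s : ℂ) * z)) (linX z) (linY z)
  vertex_iff : ∀ f, ∀ x ∈ S.polygon f,
    (∃ i, S.vertex f i = x) ↔ ∃ q ∈ T, develop f x = C.cell q 0 0

namespace SquareModel

variable {N Q : Type*} {c : Perm Q} {C : SquareChart N c} {T : Set Q}

/-- The map of surfaces given by a development. -/
def toMap (M : S.SquareModel C T) : S.Point → N :=
  Quot.lift (fun x => M.develop x.1.1 x.1.2) M.develop_eq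

theorem toMap_of_represents (M : S.SquareModel C T) {f : S.Face} {x : ℂ} {P : S.Point}
    (h : S.Represents f x P) : M.toMap P = M.develop f x := by
  obtain ⟨hx, rfl⟩ := h
  rfl

theorem corners_nonempty_iff (M : S.SquareModel C T) (P : S.Point) :
    (S.corners P).Nonempty ↔ ∃ q ∈ T, M.toMap P = C.cell q 0 0 := by
  constructor
  · rintro ⟨⟨f, i⟩, h⟩
    rw [M.toMap_of_represents h]
    exact (M.vertex_iff f _ (S.vertex_mem_polygon f i)).1 ⟨i, rfl⟩
  · intro h
    obtain ⟨⟨⟨f, x⟩, hx⟩, rfl⟩ := Quot.exists_rep P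
    obtain ⟨i, rfl⟩ := (M.vertex_iff f x hx).2 h
    exact ⟨(f, i), hx, rfl⟩

theorem ray_toMap (M : S.SquareModel C T) {γ : ℝ → S.Point} {f : S.Face} {x z : ℂ}
    (h : ∀ᶠ s : ℝ in 𝓝[≥] 0, S.Represents f (x + (s : ℂ) * z) (γ s)) :
    C.Ray (fun s => M.toMap (γ s)) (M.linX z) (M.linY z) := by
  obtain ⟨q, u, v, hq⟩ := M.ray f x z (h.mono fun s hs => hs.1)
  refine ⟨q, u, v, ?_⟩
  filter_upwards [hq, h] with s ⟨hu, hv, e⟩ hs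
  exact ⟨hu, hv, (M.toMap_of_represents hs).trans e⟩

theorem not_exists_isClosedSaddleConnection (M : S.SquareModel C T)
    {P : Perm Q → Perm Q → Prop} (hP : MoveInvariant P) (hT : ∀ q ∉ T, c q = q)
    (hret : ∀ h v, P h v → NoReturn c T h) (hC : P C.right C.up)
    (hsing : ∀ P, (S.corners P).Nonempty → S.IsSingular P) :
    ¬ ∃ γ, S.IsClosedSaddleConnection γ := by
  rintro ⟨γ, ⟨z, hz, hafter, hbefore, hγ0, -, hγ⟩, hclosed⟩
  have hstraight : C.Straight (fun t => M.toMap (γ t)) (M.linX z) (M.linY z) := by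
    refine ⟨fun t ht => ?_, fun t ht => ?_⟩
    · obtain ⟨f, x, ε, hε, h⟩ := hafter t ht
      exact M.ray_toMap (f := f) (x := x) (mem_of_superset (Icc_mem_nhdsGE hε) h)
    · obtain ⟨f, x, ε, hε, h⟩ := hbefore t ht
      simp only [sub_eq_add_neg x, ← mul_neg] at h
      rw [← map_neg, ← map_neg]
      exact M.ray_toMap (f := f) (x := x) (mem_of_superset (Icc_mem_nhdsGE hε) h)
  refine hstraight.ne_of_moveInvariant hP hT hret hC ?_
    ((M.corners_nonempty_iff _).1 hγ0.corners_nonempty) (fun t ht q hq e => ?_)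
    (congrArg M.toMap hclosed)
  · by_contra! h
    exact hz (M.eq_zero_of_lin z h.1 h.2)
  · exact hγ t ht (hsing _ ((M.corners_nonempty_iff _).2 ⟨q, hq, e⟩))

end SquareModel

end RegularPolygonGluing

theorem eq_of_convexCombination_eq_zero_or_one {u v w s t : ℝ} (hu : u ∈ Icc (0 : ℝ) 1)
    (hv : v ∈ Icc (0 : ℝ) 1) (hs : 0 < s) (ht : 0 < t) (hst : s + t = 1) (h : s * u + t * v = w)
    (hw : w = 0 ∨ w = 1) : u = w := by
  obtain rfl : t = 1 - s := by linarith
  rcases hw with rfl | rfl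
  · nlinarith [mul_nonneg hs.le hu.1, mul_nonneg ht.le hv.1]
  · nlinarith [mul_nonneg hs.le (sub_nonneg.2 hu.2), mul_nonneg ht.le (sub_nonneg.2 hv.2)]

theorem SquareChart.exists_cell_zero_iff {N Q : Type*} {c : Perm Q} (C : SquareChart N c) {q : Q}
    {x y : ℝ} (hx : x ∈ Icc (0 : ℝ) 1) (hy : y ∈ Icc (0 : ℝ) 1) :
    (∃ q', C.cell q x y = C.cell q' 0 0) ↔ (x = 0 ∨ x = 1) ∧ (y = 0 ∨ y = 1) := by
  constructor
  · rintro ⟨q', e⟩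
    have hpos := congrArg C.pos e
    rw [C.pos_cell_zero, C.pos_cell q x hx y hy, ← torusPoint_zero, torusPoint_eq_iff] at hpos
    obtain ⟨⟨m, hm⟩, n, hn⟩ := hpos
    exact ⟨eq_zero_or_one_of_intCast hx (by simpa using hm),
      eq_zero_or_one_of_intCast hy (by simpa using hn)⟩
  · rintro ⟨rfl | rfl, rfl | rfl⟩
    · exact ⟨q, rfl⟩
    · exact ⟨_, C.cell_up q 0 (by simp)⟩
    · exact ⟨_, C.cell_right q 0 (by simp)⟩
    · exact ⟨_, (C.cell_right q 1 (by simp)).trans (C.cell_up _ 0 (by simp))⟩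

namespace RegularPolygonGluing

variable {S : RegularPolygonGluing p}

/-- An affine bijection of the plane that takes each vertex of a polygon to one of the four corners
of the unit square. -/
structure SquareCoordinates (S : RegularPolygonGluing p) where
  linX : ℂ →ₗ[ℝ] ℝ
  linY : ℂ →ₗ[ℝ] ℝ
  eq_zero_of_lin : ∀ z, linX z = 0 → linY z = 0 → z = 0
  shiftX : S.Face → ℝ
  shiftY : S.Face → ℝ
  vertexX : ∀ f i, linX (S.vertex f i) + shiftX f = 0 ∨ linX (S.vertex f i) + shiftX f = 1
  vertexY : ∀ f i, linY (S.vertex f i) + shiftY f = 0 ∨ linY (S.vertex f i) + shiftY f = 1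

namespace SquareCoordinates

variable (K : S.SquareCoordinates)

theorem mem_Icc {f : S.Face} {x : ℂ} (hx : x ∈ S.polygon f) :
    K.linX x + K.shiftX f ∈ Icc (0 : ℝ) 1 ∧ K.linY x + K.shiftY f ∈ Icc (0 : ℝ) 1 := by
  have mem_Icc_iff (u v : ℝ) : u + v ∈ Icc (0 : ℝ) 1 ↔ u ∈ Icc (-v) (1 - v) := by
    simp [neg_le_iff_add_nonneg, le_sub_iff_add_le]
  have hconv (A : ℂ →ₗ[ℝ] ℝ) (v : ℝ) : Convex ℝ {x | A x + v ∈ Icc (0 : ℝ) 1} := by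
    simp only [mem_Icc_iff]
    exact (convex_Icc _ _).linear_preimage A
  refine S.polygon_subset ((hconv _ _).inter (hconv _ _)) (fun i => ⟨?_, ?_⟩) hx
  · rcases K.vertexX f i with h | h <;> simp [h]
  · rcases K.vertexY f i with h | h <;> simp [h]

theorem exists_vertex_eq_iff {f : S.Face} {x : ℂ} (hx : x ∈ S.polygon f) :
    (∃ i, S.vertex f i = x) ↔ (K.linX x + K.shiftX f = 0 ∨ K.linX x + K.shiftX f = 1) ∧
      (K.linY x + K.shiftY f = 0 ∨ K.linY x + K.shiftY f = 1) := by
  refine ⟨fun ⟨i, hi⟩ => hi ▸ ⟨K.vertexX f i, K.vertexY f i⟩, fun ⟨hX, hY⟩ => ?_⟩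
  have hextreme : x ∈ (S.polygon f).extremePoints ℝ := by
    refine mem_extremePoints_iff_left.2 ⟨hx, fun x₁ hx₁ x₂ hx₂ hmem => ?_⟩
    obtain ⟨s, t, hs, ht, hst, rfl⟩ := hmem
    obtain ⟨h₁X, h₁Y⟩ := K.mem_Icc hx₁
    obtain ⟨h₂X, h₂Y⟩ := K.mem_Icc hx₂
    have combine (A : ℂ →ₗ[ℝ] ℝ) (v : ℝ) :
        s * (A x₁ + v) + t * (A x₂ + v) = A (s • x₁ + t • x₂) + v := by
      rw [map_add, map_smul, map_smul, smul_eq_mul, smul_eq_mul]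
      linear_combination v * hst
    have eX := eq_of_convexCombination_eq_zero_or_one h₁X h₂X hs ht hst (combine _ _) hX
    have eY := eq_of_convexCombination_eq_zero_or_one h₁Y h₂Y hs ht hst (combine _ _) hY
    refine sub_eq_zero.1 (K.eq_zero_of_lin _ ?_ ?_)
    · rw [map_sub, add_right_cancel eX, sub_self]
    · rw [map_sub, add_right_cancel eY, sub_self]
  have hvertex : x ∈ range (S.vertex f) := extremePoints_convexHull_subset hextreme
  exact hvertex

/-- The development that places the polygon `f` in the square numbered `q f`. -/
def squareModel {N Q : Type*} {c : Perm Q} (C : SquareChart N c) (q : S.Face → Q)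
    (hq : ∀ x y : S.PolygonPoint, S.Identified x y →
      C.cell (q x.1.1) (K.linX x.1.2 + K.shiftX x.1.1) (K.linY x.1.2 + K.shiftY x.1.1) =
        C.cell (q y.1.1) (K.linX y.1.2 + K.shiftX y.1.1) (K.linY y.1.2 + K.shiftY y.1.1)) :
    S.SquareModel C univ where
  develop f x := C.cell (q f) (K.linX x + K.shiftX f) (K.linY x + K.shiftY f)
  linX := K.linX
  linY := K.linY
  eq_zero_of_lin := K.eq_zero_of_lin
  develop_eq := hq
  ray f x z h := by
    refine ⟨q f, K.linX x + K.shiftX f, K.linY x + K.shiftY f, h.mono fun s hs => ?_⟩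
    have move (A : ℂ →ₗ[ℝ] ℝ) (v : ℝ) : A (x + s * z) + v = A x + v + s * A z := by
      rw [map_add, ← Complex.real_smul, map_smul, smul_eq_mul]
      ring
    obtain ⟨hX, hY⟩ := K.mem_Icc hs
    rw [move] at hX hY
    exact ⟨hX, hY, by simp only [move]⟩
  vertex_iff f x hx := by
    obtain ⟨hX, hY⟩ := K.mem_Icc hx
    rw [K.exists_vertex_eq_iff hx, ← C.exists_cell_zero_iff (q := q f) hX hY]
    simp

end SquareCoordinates

end RegularPolygonGluing

/-! ### Translation covers and edge labellings -/

theorem orderOf_le_ncard {M : Type*} [Group M] {s : Set M} (hs : s.Finite) {x a : M} (hx : x ∈ s)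
    (h : ∀ y ∈ s, y * a ∈ s) : orderOf a ≤ s.ncard := by
  have hpow (n : ℕ) : x * a ^ n ∈ s := by
    induction n with
    | zero => rwa [pow_zero, mul_one]
    | succ n ih => rw [pow_succ, ← mul_assoc]; exact h _ ih
  have hsub : (x * ·) '' (Submonoid.powers a : Set M) ⊆ s := by
    rintro _ ⟨_, ⟨n, rfl⟩, rfl⟩
    exact hpow n
  calc orderOf a = ((x * ·) '' (Submonoid.powers a : Set M)).ncard := by
        rw [ncard_image_of_injective _ (mul_right_injective x), ← Nat.card_submonoidPowers]
        rfl
    _ ≤ s.ncard := ncard_le_ncard hsub hs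

theorem lt_orderOf_of_pow_ne_one {M : Type*} [LeftCancelMonoid M] [Finite M] {a : M} {k : ℕ}
    (h : ∀ i ≤ k, 0 < i → a ^ i ≠ 1) : k < orderOf a := by
  by_contra! hk
  exact h _ hk (orderOf_pos a) (pow_orderOf_eq_one a)

variable {p : ℕ}

/-- The points of the edges of a regular polygon inscribed in the unit circle, the edges being
numbered by the directions of their initial vertices. -/
def edgePoint (p r : ℕ) (t : ℝ) : ℂ := (1 - t) * unitRoot p ^ r + t * unitRoot p ^ (r + 2)

theorem map_edgePoint (A : ℂ →ₗ[ℝ] ℝ) (r : ℕ) (t : ℝ) :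
    A (edgePoint p r t) = (1 - t) * A (unitRoot p ^ r) + t * A (unitRoot p ^ (r + 2)) := by
  rw [← smul_eq_mul, ← smul_eq_mul, ← map_smul, ← map_smul, ← map_add, edgePoint]
  simp

variable [NeZero p]

theorem pow_val_add_one {M : Type*} [Monoid M] {a : M} (ha : a ^ p = 1) (i : Fin p) :
    a ^ ((i + 1 : Fin p) : ℕ) = a ^ (i : ℕ) * a := by
  rw [← pow_succ]
  exact pow_eq_pow_of_modEq (val_add_one_modEq i) ha

theorem edgePoint_congr {r s : ℕ} (h : r ≡ s [MOD 2 * p]) (t : ℝ) :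
    edgePoint p r t = edgePoint p s t := by
  rw [edgePoint, edgePoint, unitRoot_pow_eq_iff.2 h, unitRoot_pow_eq_iff.2 (h.add_right 2)]

theorem edgePoint_add_self (r : ℕ) (t : ℝ) : edgePoint p (r + p) t = -edgePoint p r t := by
  rw [edgePoint, edgePoint, add_right_comm, pow_add _ r p, pow_add _ (r + 2) p, unitRoot_pow_self]
  ring

namespace PeriodicPolyhedralSurface

variable {X : PeriodicPolyhedralSurface p}

theorem SameEdge.symm {e e' : X.Face × Fin p} (h : X.SameEdge e e') : X.SameEdge e' e := by
  obtain ⟨m, h₁, h₂⟩ := h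
  refine ⟨-m, ?_, ?_⟩
  · simp only [h₂, Pi.neg_apply, Int.cast_neg, neg_smul, Finset.sum_neg_distrib,
      add_neg_cancel_right]
  · simp only [h₁, Pi.neg_apply, Int.cast_neg, neg_smul, Finset.sum_neg_distrib,
      add_neg_cancel_right]

/-- The direction of the vertex `i` of a placed face, from which the edge `i` starts, as a multiple
of `π / p`. -/
def normalIndex (c : X.PlacedFace) (i : Fin p) : ℕ := c.2 + 2 * i

theorem regularVertex_placedAngle (c : X.PlacedFace) (i : Fin p) :
    regularVertex p (X.placedAngle c) i = unitRoot p ^ normalIndex c i :=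
  regularVertex_eq_unitRoot_pow _ _

theorem normalIndex_add_one (c : X.PlacedFace) (i : Fin p) :
    normalIndex c (i + 1) ≡ normalIndex c i + 2 [MOD 2 * p] := by
  have h := ((val_add_one_modEq i).mul_left' 2).add_left (c.2 : ℕ)
  rwa [mul_add, mul_one, ← add_assoc] at h

theorem regularVertex_placedAngle_add_one (c : X.PlacedFace) (i : Fin p) :
    regularVertex p (X.placedAngle c) (i + 1) = unitRoot p ^ (normalIndex c i + 2) := by
  rw [regularVertex_placedAngle, unitRoot_pow_eq_iff]
  exact normalIndex_add_one c i

theorem edgeVector_eq_neg_iff (hp : 2 ≤ p) (c c' : X.PlacedFace) (i j : Fin p) :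
    X.edgeVector c i = -X.edgeVector c' j ↔
      normalIndex c' j ≡ normalIndex c i + p [MOD 2 * p] := by
  have edgeVector_eq (c : X.PlacedFace) (i : Fin p) :
      X.edgeVector c i = unitRoot p ^ normalIndex c i * (unitRoot p ^ 2 - 1) := by
    rw [edgeVector, regularVertex_placedAngle_add_one, regularVertex_placedAngle, pow_add]
    ring
  have hne : unitRoot p ^ 2 - 1 ≠ 0 := by
    rw [sub_ne_zero, ← pow_zero (unitRoot p), Ne, unitRoot_pow_eq_iff, Nat.modEq_zero_iff_dvd]
    exact fun h => by have := Nat.le_of_dvd two_pos h; omega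
  rw [edgeVector_eq, edgeVector_eq, ← neg_mul, mul_left_inj' hne, ← unitRoot_pow_eq_iff, pow_add,
    unitRoot_pow_self, mul_neg_one, eq_neg_iff_add_eq_zero, eq_neg_iff_add_eq_zero, add_comm]

/-- A placed face is glued to another one along the edge that starts in the direction `π * r / p`
from its centre. -/
def GluedAt (c c' : X.PlacedFace) (r : ℕ) : Prop :=
  ∃ i j : Fin p, X.SameEdge (c.1, i) (c'.1, j) ∧ normalIndex c i ≡ r [MOD 2 * p] ∧
    normalIndex c' j ≡ r + p [MOD 2 * p]

theorem GluedAt.congr {c c' : X.PlacedFace} {r s : ℕ} (h : GluedAt c c' r)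
    (hrs : r ≡ s [MOD 2 * p]) : GluedAt c c' s := by
  obtain ⟨i, j, he, hi, hj⟩ := h
  exact ⟨i, j, he, hi.trans hrs, hj.trans (hrs.add_right p)⟩

theorem GluedAt.symm {c c' : X.PlacedFace} {r : ℕ} (h : GluedAt c c' r) :
    GluedAt c' c (r + p) := by
  obtain ⟨i, j, he, hi, hj⟩ := h
  refine ⟨j, i, he.symm, hj, hi.trans ?_⟩
  rw [add_assoc, ← two_mul]
  exact Nat.add_modEq_right.symm

theorem PlacedGlued.gluedAt (hp : 2 ≤ p) {c c' : X.PlacedFace} {i j : Fin p}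
    (h : X.PlacedGlued (c, i) (c', j)) : GluedAt c c' (normalIndex c i) :=
  ⟨i, j, h.1, rfl, (edgeVector_eq_neg_iff hp _ _ _ _).1 h.2⟩

theorem GluedAt.even_iff (hp : Even p) {c c' : X.PlacedFace} {r : ℕ} (h : GluedAt c c' r) :
    (Even (c.2 : ℕ) ↔ Even r) ∧ (Even (c'.2 : ℕ) ↔ Even r) := by
  obtain ⟨i, j, -, hi, hj⟩ := h
  replace hi : _ % 2 = _ := hi.of_mul_right p
  replace hj : _ % 2 = _ := hj.of_mul_right p
  rw [normalIndex] at hi hj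
  simp only [Nat.even_iff] at hp ⊢
  omega

variable {f₀ : X.Face}

theorem even_turn (hp : 2 ≤ p) (hp_even : Even p) (c : (X.translationCover f₀).Face) :
    Even (c.1.2 : ℕ) := by
  obtain ⟨c, hc⟩ := c
  induction hc with
  | refl => simp
  | tail _ h ih =>
    obtain ⟨i, j, h⟩ := h
    obtain ⟨h₁, h₂⟩ := (h.gluedAt hp).even_iff hp_even
    exact h₂.2 (h₁.1 ih)

theorem translationCover_vertex (c : (X.translationCover f₀).Face) (i : Fin p) :
    (X.translationCover f₀).vertex c i = unitRoot p ^ normalIndex c.1 i :=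
  regularVertex_placedAngle c.1 i

theorem translationCover_vertex_add_one (c : (X.translationCover f₀).Face) (i : Fin p) :
    (X.translationCover f₀).vertex c (i + 1) = unitRoot p ^ (normalIndex c.1 i + 2) :=
  regularVertex_placedAngle_add_one c.1 i

theorem exists_gluedAt_of_identified (hp : 2 ≤ p) {x y : (X.translationCover f₀).PolygonPoint}
    (h : (X.translationCover f₀).Identified x y) :
    ∃ r < 2 * p, ∃ t ∈ Icc (0 : ℝ) 1, GluedAt x.1.1.1 y.1.1.1 r ∧ x.1.2 = edgePoint p r t ∧
      y.1.2 = edgePoint p (r + p) (1 - t) := by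
  obtain ⟨i, j, hglued, hmem, hy⟩ := h
  have hat := hglued.gluedAt hp
  set n := normalIndex x.1.1.1 i with hn
  rw [translationCover_vertex, translationCover_vertex_add_one, ← hn, segment_eq_image] at hmem
  obtain ⟨t, ht, hx⟩ := hmem
  have hmod : n ≡ n % (2 * p) [MOD 2 * p] := (Nat.mod_modEq _ _).symm
  refine ⟨n % (2 * p), Nat.mod_lt _ (NeZero.pos _), t, ht, hat.congr hmod, ?_, ?_⟩
  · rw [← edgePoint_congr hmod, ← hx, edgePoint]
    simp
  · have hj := ((edgeVector_eq_neg_iff hp _ _ _ _).1 hglued.2).add_right 2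
    rw [← edgePoint_congr (hmod.add_right p), edgePoint_add_self, hy,
      translationCover_vertex_add_one, unitRoot_pow_eq_iff.2 hj, translationCover_vertex, ← hn,
      ← hx, add_right_comm n p, pow_add _ (n + 2) p, unitRoot_pow_self, edgePoint]
    simp only [Complex.real_smul, Complex.ofReal_sub, Complex.ofReal_one]
    ring

theorem develop_eq_of_identified (hp : 2 ≤ p) {N : Type*}
    {develop : (X.translationCover f₀).Face → ℂ → N}
    (h : ∀ c c' : (X.translationCover f₀).Face, ∀ r < p, GluedAt c.1 c'.1 r →
      ∀ t ∈ Icc (0 : ℝ) 1, develop c (edgePoint p r t) = develop c' (-edgePoint p r (1 - t)))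
    {x y : (X.translationCover f₀).PolygonPoint} (hxy : (X.translationCover f₀).Identified x y) :
    develop x.1.1 x.1.2 = develop y.1.1 y.1.2 := by
  obtain ⟨r, hr, t, ht, hat, hx, hy⟩ := exists_gluedAt_of_identified hp hxy
  rw [hx, hy, edgePoint_add_self]
  rcases lt_or_ge r p with hrp | hrp
  · exact h _ _ r hrp hat t ht
  · obtain ⟨s, rfl⟩ := Nat.exists_eq_add_of_le' hrp
    have hmod : s + p + p ≡ s [MOD 2 * p] := by
      rw [add_assoc, ← two_mul]
      exact Nat.add_modEq_right
    have h := h _ _ s (by omega) (hat.symm.congr hmod) (1 - t)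
      (by simpa [and_comm] using ht)
    rw [edgePoint_add_self, edgePoint_add_self, neg_neg, h, sub_sub_cancel]

/-- A labelling of the oriented edges by the elements of a group in which the next edge of a face is
obtained by multiplication with `R`, and the same edge of the neighbouring face by multiplication
with `E`. On a connected surface it is determined by `R`, `E` and one label. -/
structure EdgeLabelling (X : PeriodicPolyhedralSurface p) (G : Type*) [Group G] where
  face : X.Face → G
  R : G
  E : G
  R_pow : R ^ p = 1
  E_mul_E : E * E = 1
  sameEdge : ∀ f i g j, X.SameEdge (f, i) (g, j) →
    face f * R ^ (i : ℕ) * E = face g * R ^ (j : ℕ)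

/-- Every edge of the surface belongs to a second face. -/
def IsClosedSurface (X : PeriodicPolyhedralSurface p) : Prop :=
  ∀ f i, ∃ g j, X.SameEdge (f, i) (g, j)

theorem IsClosedSurface.exists_placedGlued (hX : X.IsClosedSurface) (hp : 2 ≤ p)
    (c : X.PlacedFace) (i : Fin p) : ∃ c' j, X.PlacedGlued (c, i) (c', j) := by
  obtain ⟨g, j, he⟩ := hX c.1 i
  have hj := j.2
  refine ⟨(g, Fin.ofNat _ (normalIndex c i + p + (2 * p - 2 * j))), j, he,
    (edgeVector_eq_neg_iff hp _ _ _ _).2 ?_⟩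
  calc _ ≡ normalIndex c i + p + (2 * p - 2 * j) + 2 * j [MOD 2 * p] :=
        (Nat.mod_modEq _ _).add_right _
    _ = normalIndex c i + p + 2 * p := by omega
    _ ≡ normalIndex c i + p [MOD 2 * p] := Nat.add_modEq_right

namespace EdgeLabelling

variable {G : Type*} [Group G] (l : X.EdgeLabelling G)

/-- The label of the edge after a corner of a placed face, together with the direction of the
corner. -/
def cornerLabel (e : X.PlacedFace × Fin p) : G × Multiplicative (ZMod (2 * p)) :=
  (l.face e.1.1 * l.R ^ (e.2 : ℕ), .ofAdd (normalIndex e.1 e.2 : ZMod (2 * p)))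

/-- The quotient of the labels of consecutive corners around a vertex. -/
def cornerTurn : G × Multiplicative (ZMod (2 * p)) :=
  (l.E * l.R, .ofAdd (p + 2 : ZMod (2 * p)))

theorem cornerLabel_of_placedGlued (hp : 2 ≤ p) {c c' : X.PlacedFace} {i j : Fin p}
    (h : X.PlacedGlued (c, i) (c', j)) :
    l.cornerLabel (c', j + 1) = l.cornerLabel (c, i) * l.cornerTurn := by
  have hindex := (normalIndex_add_one c' j).trans
    (((edgeVector_eq_neg_iff hp _ _ _ _).1 h.2).add_right 2)
  refine Prod.ext ?_ (congrArg Multiplicative.ofAdd ?_)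
  · simp only [cornerLabel, cornerTurn, Prod.fst_mul]
    rw [pow_val_add_one l.R_pow, ← mul_assoc, ← mul_assoc, ← l.sameEdge _ _ _ _ h.1]
  · change _ = (normalIndex c i : ZMod (2 * p)) + (p + 2)
    rw [← add_assoc]
    exact mod_cast (ZMod.natCast_eq_natCast_iff _ _ _).2 hindex

theorem exists_next_corner (hp : 2 ≤ p) (hX : X.IsClosedSurface)
    {P : (X.translationCover f₀).Point} {e : (X.translationCover f₀).Face × Fin p}
    (he : e ∈ (X.translationCover f₀).corners P) :
    ∃ e' ∈ (X.translationCover f₀).corners P,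
      l.cornerLabel (e'.1.1, e'.2) = l.cornerLabel (e.1.1, e.2) * l.cornerTurn := by
  obtain ⟨⟨c, hc⟩, i⟩ := e
  obtain ⟨hmem, rfl⟩ := he
  obtain ⟨c', j, hglued⟩ := hX.exists_placedGlued hp c i
  let d : (X.translationCover f₀).Face := ⟨c', hc.tail ⟨i, j, hglued⟩⟩
  have hmem' := (X.translationCover f₀).vertex_mem_polygon d (j + 1)
  have hident : (X.translationCover f₀).Identified ⟨(⟨c, hc⟩, _), hmem⟩ ⟨(d, _), hmem'⟩ :=
    ⟨i, j, hglued, left_mem_segment _ _ _, (add_sub_cancel _ _).symm⟩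
  exact ⟨(d, j + 1), ⟨hmem', (Quot.sound hident).symm⟩, l.cornerLabel_of_placedGlued hp hglued⟩

theorem isSingular [Finite X.Face] (hX : X.IsClosedSurface)
    (hl : 2 * p < orderOf l.cornerTurn * (p - 2)) {P : (X.translationCover f₀).Point}
    (hP : ((X.translationCover f₀).corners P).Nonempty) :
    (X.translationCover f₀).IsSingular P := by
  have hp : 2 ≤ p := by
    by_contra! h
    rw [Nat.sub_eq_zero_of_le h.le] at hl
    omega
  have : Finite (X.translationCover f₀).Face := inferInstanceAs (Finite (Subtype _))
  set s := (X.translationCover f₀).corners P with hs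
  obtain ⟨e, he⟩ := hP
  have hcard : orderOf l.cornerTurn ≤ s.ncard := by
    refine (orderOf_le_ncard (s := (fun e => l.cornerLabel (e.1.1, e.2)) '' s)
      (toFinite _) (mem_image_of_mem _ he) ?_).trans (ncard_image_le (toFinite _))
    rintro _ ⟨e, he, rfl⟩
    obtain ⟨e', he', h⟩ := l.exists_next_corner hp hX he
    exact ⟨e', he', h⟩
  have hp0 : (0 : ℝ) < p := Nat.cast_pos.2 (NeZero.pos p)
  have hlt : 2 * (p : ℝ) < s.ncard * (p - 2) := by
    have := hl.trans_le (Nat.mul_le_mul_right (p - 2) hcard)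
    rw [← Nat.cast_two, ← Nat.cast_sub hp]
    exact_mod_cast this
  rw [RegularPolygonGluing.IsSingular, RegularPolygonGluing.vertexAngle, ← hs, ← mul_div_assoc,
    lt_div_iff₀ hp0]
  nlinarith [Real.pi_pos]

/-- The label of the edge of a placed face that starts in the direction `0` if the face is turned by
an even multiple of `π / p`. -/
def placed (c : X.PlacedFace) : G := l.face c.1 * (l.R ^ ((c.2 : ℕ) / 2))⁻¹

theorem placed_eq_of_gluedAt {q : ℕ} (hq : p = 2 * q) {c c' : X.PlacedFace} {k : ℕ}
    (h : GluedAt c c' (2 * k)) :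
    l.placed c' = l.placed c * l.R ^ k * l.E * (l.R ^ (k + q))⁻¹ := by
  obtain ⟨⟨m, hm⟩, m', hm'⟩ := (h.even_iff (even_iff_two_dvd.2 ⟨q, hq⟩)).imp
    (·.2 (even_two_mul k)) (·.2 (even_two_mul k))
  obtain ⟨i, j, he, hi, hj⟩ := h
  have halve {a b : ℕ} (h : 2 * a ≡ 2 * b [MOD 2 * p]) : l.R ^ a = l.R ^ b :=
    pow_eq_pow_of_modEq (Nat.ModEq.mul_left_cancel' two_ne_zero h) l.R_pow
  have hi : l.R ^ (i : ℕ) * l.R ^ m = l.R ^ k := by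
    rw [← pow_add, add_comm]
    refine halve ?_
    rwa [mul_add, two_mul m, ← hm]
  have hj : l.R ^ (j : ℕ) * l.R ^ m' = l.R ^ (k + q) := by
    rw [← pow_add, add_comm]
    refine halve ?_
    rwa [mul_add, two_mul m', ← hm', mul_add, ← hq]
  have hface := l.sameEdge _ _ _ _ he
  rw [← hi, ← hj, placed, placed, hm, hm', ← two_mul, ← two_mul, Nat.mul_div_cancel_left _ two_pos,
    Nat.mul_div_cancel_left _ two_pos, eq_mul_inv_of_mul_eq hface.symm]
  rw [(Commute.pow_pow_self l.R i m).eq]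
  group

end EdgeLabelling

end PeriodicPolyhedralSurface

theorem RegularPolygonGluing.SquareModel.not_exists_isClosedSaddleConnection_of_mulRight {p : ℕ}
    [NeZero p] {S : RegularPolygonGluing p} {G : Type*} [Group G] {a b g : G}
    (M : S.SquareModel (SquareChart.ofPerms (Equiv.mulRight a) (Equiv.mulRight b)) univ)
    (hg : g ∈ Subgroup.closure {a, b})
    (h : ∀ a' b' : G, a'⁻¹ * b'⁻¹ * a' * b' = a⁻¹ * b⁻¹ * a * b → g ∈ Subgroup.closure {a', b'} →
      a' ∉ Subgroup.zpowers (a⁻¹ * b⁻¹ * a * b))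
    (hsing : ∀ P, (S.corners P).Nonempty → S.IsSingular P) :
    ¬ ∃ γ, S.IsClosedSaddleConnection γ := by
  refine M.not_exists_isClosedSaddleConnection
    (moveInvariant_rightMulPair (a⁻¹ * b⁻¹ * a * b) g) (by simp) ?_ ⟨a, b, rfl, rfl, rfl, hg⟩ hsing
  rintro _ _ ⟨a', b', rfl, rfl, hab, hg'⟩
  rw [mulRight_commutator]
  exact noReturn_mulRight (h a' b' hab hg')

namespace PeriodicPolyhedralSurface

/-! ### Surfaces made of squares -/

section Square

variable {X : PeriodicPolyhedralSurface 4} {f₀ : X.Face} {G : Type*} [Group G]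

theorem unitRoot_four_pow (k : ℕ) : unitRoot 4 ^ (2 * k) = Complex.I ^ k := by
  rw [pow_mul, unitRoot_two_mul_pow_two 2, unitRoot_two]

theorem I_pow_mem (k : ℕ) : Complex.I ^ k ∈ ({1, Complex.I, -1, -Complex.I} : Set ℂ) := by
  rw [Complex.I_pow_eq_pow_mod]
  have : k % 4 < 4 := Nat.mod_lt _ (by simp)
  interval_cases k % 4 <;> simp

theorem squareCover_vertex_mem (c : (X.translationCover f₀).Face) (i : Fin 4) :
    (X.translationCover f₀).vertex c i ∈ ({1, Complex.I, -1, -Complex.I} : Set ℂ) := by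
  obtain ⟨m, hm⟩ := (even_turn (by simp) (by decide) c).two_dvd
  rw [translationCover_vertex, normalIndex, hm, ← mul_add, unitRoot_four_pow]
  exact I_pow_mem _

/-- The coordinates that turn and shrink the square with the vertices `±1`, `±I` to the unit
square. -/
def squareCoordinates (X : PeriodicPolyhedralSurface 4) (f₀ : X.Face) :
    (X.translationCover f₀).SquareCoordinates where
  linX := (1 / 2 : ℝ) • (Complex.reLm + Complex.imLm)
  linY := (1 / 2 : ℝ) • (Complex.imLm - Complex.reLm)
  eq_zero_of_lin z hx hy := by
    simp only [LinearMap.smul_apply, LinearMap.add_apply, LinearMap.sub_apply, Complex.reLm_coe,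
      Complex.imLm_coe, smul_eq_mul] at hx hy
    exact Complex.ext (by simp; linarith) (by simp; linarith)
  shiftX _ := 1 / 2
  shiftY _ := 1 / 2
  vertexX c i := by
    rcases squareCover_vertex_mem c i with h | h | h | h <;> rw [h] <;> norm_num
  vertexY c i := by
    rcases squareCover_vertex_mem c i with h | h | h | h <;> rw [h] <;> norm_num

namespace EdgeLabelling

variable (l : X.EdgeLabelling G)

/-- The label of the square to the right, relative to a square. -/
def squareRight : G := l.E * l.R ^ 2

/-- The label of the square above, relative to a square. -/
def squareUp : G := l.R * l.E * l.R

theorem placed_eq_mul_squareRight {c c' : X.PlacedFace} (h : GluedAt c c' 0) :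
    l.placed c' = l.placed c * l.squareRight := by
  rw [l.placed_eq_of_gluedAt (q := 2) (k := 0) rfl h, squareRight,
    inv_eq_of_mul_eq_one_left (a := l.R ^ 2) (by rw [← l.R_pow, ← pow_add])]
  group

theorem placed_eq_mul_squareUp {c c' : X.PlacedFace} (h : GluedAt c c' 2) :
    l.placed c' = l.placed c * l.squareUp := by
  rw [l.placed_eq_of_gluedAt (q := 2) (k := 1) rfl h, squareUp,
    inv_eq_of_mul_eq_one_left (a := l.R) (by rw [← l.R_pow, ← pow_succ'])]
  group

/-- The chart in which a square is numbered by its label. -/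
def squareChart : SquareChart (Set G × UnitAddCircle × UnitAddCircle)
    (Equiv.mulRight l.squareUp * Equiv.mulRight l.squareRight *
      (Equiv.mulRight l.squareUp)⁻¹ * (Equiv.mulRight l.squareRight)⁻¹) :=
  SquareChart.ofPerms (Equiv.mulRight l.squareRight) (Equiv.mulRight l.squareUp)

/-- The map of the translation cover that sends each square to the one with its label. -/
def squareModel (f₀ : X.Face) : (X.translationCover f₀).SquareModel l.squareChart univ :=
  (squareCoordinates X f₀).squareModel l.squareChart (fun c => l.placed c.1) fun x y hxy => by
    refine develop_eq_of_identified (by simp) (develop := fun c z =>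
      l.squareChart.cell (l.placed c.1) ((squareCoordinates X f₀).linX z + 1 / 2)
        ((squareCoordinates X f₀).linY z + 1 / 2)) (fun c c' r hr h t ht => ?_) hxy
    obtain ⟨k, rfl⟩ := ((h.even_iff (by decide)).1.1 (even_turn (by simp) (by decide) c)).two_dvd
    rw [map_neg, map_neg, map_edgePoint, map_edgePoint, map_edgePoint, map_edgePoint,
      ← mul_add_one 2 k, unitRoot_four_pow, unitRoot_four_pow]
    have hk : k < 2 := by omega
    interval_cases k
    · have hright : l.squareChart.cell (l.placed c.1) 1 t =
          l.squareChart.cell (l.placed c'.1) 0 t :=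
        l.placed_eq_mul_squareRight h ▸ l.squareChart.cell_right _ t ht
      convert hright using 2 <;> simp [squareCoordinates] <;> ring
    · have hup : l.squareChart.cell (l.placed c.1) (1 - t) 1 =
          l.squareChart.cell (l.placed c'.1) (1 - t) 0 :=
        l.placed_eq_mul_squareUp h ▸ l.squareChart.cell_up _ _ (by simpa [and_comm] using ht)
      convert hup using 2 <;> simp [squareCoordinates] <;> ring

theorem not_exists_isClosedSaddleConnection_of_squares [Finite X.Face] (hX : X.IsClosedSurface)
    (hl : 4 < orderOf l.cornerTurn) {c₀ g : G}
    (hc₀ : l.squareRight⁻¹ * l.squareUp⁻¹ * l.squareRight * l.squareUp = c₀)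
    (hprime : (orderOf c₀).Prime) (hg : g ∈ Subgroup.closure {l.squareRight, l.squareUp})
    (hgc : g * c₀ * g⁻¹ ∉ Subgroup.zpowers c₀) :
    ¬ ∃ γ, (X.translationCover f₀).IsClosedSaddleConnection γ := by
  subst hc₀
  exact (l.squareModel f₀).not_exists_isClosedSaddleConnection_of_mulRight hg
    (fun _ _ hab hg => notMem_zpowers_of_prime_order hprime hab hg hgc)
    fun P hP => l.isSingular hX (by omega) hP

end EdgeLabelling

end Square

end PeriodicPolyhedralSurface

/-! ### Surfaces made of triangles -/

theorem unitRoot_three_pow_two : unitRoot 3 ^ 2 = unitRoot 3 - 1 := by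
  have h3 : √3 * √3 = 3 := Real.mul_self_sqrt (by simp)
  rw [unitRoot_three]
  apply Complex.ext <;> simp [pow_two] <;> linarith

theorem unitRoot_three_pow_mem (n : ℕ) :
    (n % 2 = 0 ∧ unitRoot 3 ^ n ∈ ({1, unitRoot 3 - 1, -unitRoot 3} : Set ℂ)) ∨
      (n % 2 = 1 ∧ unitRoot 3 ^ n ∈ ({unitRoot 3, -1, 1 - unitRoot 3} : Set ℂ)) := by
  have h3 : unitRoot 3 ^ 3 = -1 := unitRoot_pow_self
  have h4 : unitRoot 3 ^ 4 = -unitRoot 3 := by rw [pow_succ, h3, neg_one_mul]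
  have h5 : unitRoot 3 ^ 5 = 1 - unitRoot 3 := by
    rw [pow_add _ 3 2, h3, unitRoot_three_pow_two]
    ring
  rw [unitRoot_pow_eq_iff.2 (Nat.mod_modEq n (2 * 3)).symm, ← Nat.mod_mod_of_dvd n ⟨3, rfl⟩]
  have hn : n % (2 * 3) < 2 * 3 := Nat.mod_lt _ (by simp)
  interval_cases n % (2 * 3) <;> simp [unitRoot_three_pow_two, h3, h4, h5]

/-- The first coordinate with respect to the basis `1`, `unitRoot 3` of the plane. -/
def hexX : ℂ →ₗ[ℝ] ℝ := Complex.reLm - (√3)⁻¹ • Complex.imLm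

/-- The second coordinate with respect to the basis `1`, `unitRoot 3` of the plane. -/
def hexY : ℂ →ₗ[ℝ] ℝ := (2 * (√3)⁻¹) • Complex.imLm

theorem eq_zero_of_hex {z : ℂ} (hx : hexX z = 0) (hy : hexY z = 0) : z = 0 := by
  have him : z.im = 0 := by simpa [hexY] using hy
  exact Complex.ext (by simpa [hexX, him] using hx) him

@[simp] theorem hexX_one : hexX 1 = 1 := by simp [hexX]

@[simp] theorem hexY_one : hexY 1 = 0 := by simp [hexY]

@[simp] theorem hexX_unitRoot_three : hexX (unitRoot 3) = 0 := by
  simp [hexX, unitRoot_three, field]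

@[simp] theorem hexY_unitRoot_three : hexY (unitRoot 3) = 1 := by
  simp [hexY, unitRoot_three, field]

namespace PeriodicPolyhedralSurface

variable {X : PeriodicPolyhedralSurface 3} {f₀ : X.Face} {G : Type*} [Group G]

theorem triangleCover_vertex_mem (c : (X.translationCover f₀).Face) (i : Fin 3) :
    ((c.1.2 : ℕ) % 2 = 0 ∧
        (X.translationCover f₀).vertex c i ∈ ({1, unitRoot 3 - 1, -unitRoot 3} : Set ℂ)) ∨
      ((c.1.2 : ℕ) % 2 = 1 ∧
        (X.translationCover f₀).vertex c i ∈ ({unitRoot 3, -1, 1 - unitRoot 3} : Set ℂ)) := by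
  rw [translationCover_vertex, ← Nat.add_mul_mod_self_left (c.1.2 : ℕ) 2 i]
  exact unitRoot_three_pow_mem _

/-- The coordinates in which the triangles become the halves of the unit square below and above its
diagonal from `(1, 0)` to `(0, 1)`, according to the parity of their turning index. -/
def triangleCoordinates (X : PeriodicPolyhedralSurface 3) (f₀ : X.Face) :
    (X.translationCover f₀).SquareCoordinates where
  linX := (1 / 3 : ℝ) • (2 • hexX + hexY)
  linY := (1 / 3 : ℝ) • (hexY - hexX)
  eq_zero_of_lin z hx hy := by
    simp only [LinearMap.smul_apply, LinearMap.add_apply, LinearMap.sub_apply, nsmul_eq_mul,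
      Nat.cast_ofNat, smul_eq_mul] at hx hy
    exact eq_zero_of_hex (by linarith) (by linarith)
  shiftX c := (1 + ((c.1.2 : ℕ) % 2 : ℕ)) / 3
  shiftY c := (1 + ((c.1.2 : ℕ) % 2 : ℕ)) / 3
  vertexX c i := by
    rcases triangleCover_vertex_mem c i with ⟨hc, h | h | h⟩ | ⟨hc, h | h | h⟩ <;>
      rw [h, hc] <;> norm_num
  vertexY c i := by
    rcases triangleCover_vertex_mem c i with ⟨hc, h | h | h⟩ | ⟨hc, h | h | h⟩ <;>
      rw [h, hc] <;> norm_num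

theorem GluedAt.turn_mod_two {c c' : X.PlacedFace} {r : ℕ} (h : GluedAt c c' r) :
    (c.2 : ℕ) % 2 = r % 2 ∧ (c'.2 : ℕ) % 2 = (r + 1) % 2 := by
  obtain ⟨i, j, -, hi, hj⟩ := h
  simp only [Nat.ModEq, normalIndex] at hi hj
  omega

namespace EdgeLabelling

variable (l : X.EdgeLabelling G)

/-- The quotient of the labels of two triangles with a common edge that starts in the direction
`π * r / 3`. -/
def cross (r : ℕ) : G := (l.R ^ r)⁻¹ * l.E * l.R ^ r

/-- The label of the edge of a placed triangle that starts in the direction `0`, or in the direction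
`π` if there is no such edge. -/
def turned (c : X.PlacedFace) : G := l.face c.1 * l.R ^ (c.2 : ℕ)

theorem cross_mul_cross (r : ℕ) : l.cross r * l.cross r = 1 := by
  calc _ = (l.R ^ r)⁻¹ * (l.E * l.E) * l.R ^ r := by rw [cross]; group
    _ = 1 := by rw [l.E_mul_E]; group

theorem turned_eq_of_gluedAt {c c' : X.PlacedFace} {r : ℕ} (h : GluedAt c c' r) :
    l.turned c' = l.turned c * l.cross r := by
  obtain ⟨i, j, he, hi, hj⟩ := h
  have hi' : l.R ^ (c.2 : ℕ) = l.R ^ (i : ℕ) * l.R ^ r := by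
    rw [← pow_add]
    refine pow_eq_pow_of_modEq ?_ l.R_pow
    simp only [Nat.ModEq, normalIndex] at hi ⊢
    omega
  have hj' : l.R ^ (c'.2 : ℕ) = l.R ^ (j : ℕ) * l.R ^ r := by
    rw [← pow_add]
    refine pow_eq_pow_of_modEq ?_ l.R_pow
    simp only [Nat.ModEq, normalIndex] at hj ⊢
    omega
  rw [turned, turned, hi', hj', ← mul_assoc, ← l.sameEdge _ _ _ _ he, cross]
  group

/-- The label of the unit square that contains a placed triangle. -/
def triangleSquare (c : X.PlacedFace) : G := l.turned c * l.E ^ ((c.2 : ℕ) % 2)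

/-- The label of the unit square to the right, relative to a unit square. -/
def triangleRight : G := l.E * l.cross 2

/-- The label of the unit square above, relative to a unit square. -/
def triangleUp : G := l.E * l.cross 1

theorem triangleSquare_eq {c c' : X.PlacedFace} (h : GluedAt c c' 0) :
    l.triangleSquare c' = l.triangleSquare c := by
  obtain ⟨hc, hc'⟩ := h.turn_mod_two
  rw [triangleSquare, triangleSquare, hc, hc', l.turned_eq_of_gluedAt h]
  simp [cross, mul_assoc, l.E_mul_E]

theorem triangleSquare_eq_mul_triangleUp {c c' : X.PlacedFace} (h : GluedAt c c' 1) :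
    l.triangleSquare c' = l.triangleSquare c * l.triangleUp := by
  obtain ⟨hc, hc'⟩ := h.turn_mod_two
  rw [triangleSquare, triangleSquare, hc, hc', l.turned_eq_of_gluedAt h, triangleUp,
    mul_assoc _ _ (l.E * _), Nat.one_mod, pow_one, ← mul_assoc l.E, l.E_mul_E]
  simp

theorem triangleSquare_eq_mul_triangleRight {c c' : X.PlacedFace} (h : GluedAt c c' 2) :
    l.triangleSquare c = l.triangleSquare c' * l.triangleRight := by
  obtain ⟨hc, hc'⟩ := h.turn_mod_two
  calc l.triangleSquare c = l.turned c * (l.cross 2 * l.cross 2) := by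
        rw [triangleSquare, hc, l.cross_mul_cross]; simp
    _ = l.turned c * l.cross 2 * (l.E * l.E) * l.cross 2 := by simp [l.E_mul_E, mul_assoc]
    _ = l.triangleSquare c' * l.triangleRight := by
        rw [triangleSquare, hc', l.turned_eq_of_gluedAt h, triangleRight]; simp [mul_assoc]

/-- The chart in which a unit square is numbered by its label. -/
def triangleChart : SquareChart (Set G × UnitAddCircle × UnitAddCircle)
    (Equiv.mulRight l.triangleUp * Equiv.mulRight l.triangleRight *
      (Equiv.mulRight l.triangleUp)⁻¹ * (Equiv.mulRight l.triangleRight)⁻¹) :=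
  SquareChart.ofPerms (Equiv.mulRight l.triangleRight) (Equiv.mulRight l.triangleUp)

/-- The map of the translation cover that sends each triangle to the unit square with its label. -/
def triangleModel (f₀ : X.Face) : (X.translationCover f₀).SquareModel l.triangleChart univ :=
  (triangleCoordinates X f₀).squareModel l.triangleChart (fun c => l.triangleSquare c.1)
    fun x y hxy => by
    refine develop_eq_of_identified (by simp) (develop := fun c z =>
      l.triangleChart.cell (l.triangleSquare c.1)
        ((triangleCoordinates X f₀).linX z + (triangleCoordinates X f₀).shiftX c)
        ((triangleCoordinates X f₀).linY z + (triangleCoordinates X f₀).shiftY c))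
        (fun c c' r hr h t ht => ?_) hxy
    obtain ⟨hc, hc'⟩ := h.turn_mod_two
    have hω : unitRoot 3 ^ 3 = -1 := unitRoot_pow_self
    have hω' : unitRoot 3 ^ 4 = -unitRoot 3 := by rw [pow_succ, hω, neg_one_mul]
    have ht' : 1 - t ∈ Icc (0 : ℝ) 1 := by simpa [and_comm] using ht
    interval_cases r
    · rw [l.triangleSquare_eq h]
      congr 1 <;> simp [triangleCoordinates, map_edgePoint, hc, hc', unitRoot_three_pow_two] <;>
        ring
    · have hup : l.triangleChart.cell (l.triangleSquare c.1) (1 - t) 1 =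
          l.triangleChart.cell (l.triangleSquare c'.1) (1 - t) 0 :=
        l.triangleSquare_eq_mul_triangleUp h ▸ l.triangleChart.cell_up _ _ ht'
      convert hup using 2 <;> simp [triangleCoordinates, map_edgePoint, hc, hc', hω] <;> ring
    · have hright : l.triangleChart.cell (l.triangleSquare c.1) 0 (1 - t) =
          l.triangleChart.cell (l.triangleSquare c'.1) 1 (1 - t) :=
        l.triangleSquare_eq_mul_triangleRight h ▸ (l.triangleChart.cell_right _ _ ht').symm
      convert hright using 2 <;>
        simp [triangleCoordinates, map_edgePoint, hc, hc', unitRoot_three_pow_two, hω'] <;> ring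

theorem not_exists_isClosedSaddleConnection_of_triangles [Finite X.Face] (hX : X.IsClosedSurface)
    (hl : 6 < orderOf l.cornerTurn)
    (hc : orderOf (l.triangleRight⁻¹ * l.triangleUp⁻¹ * l.triangleRight * l.triangleUp) = 2) :
    ¬ ∃ γ, (X.translationCover f₀).IsClosedSaddleConnection γ :=
  (l.triangleModel f₀).not_exists_isClosedSaddleConnection_of_mulRight (one_mem _)
    (fun _ _ hab _ => notMem_zpowers_of_order_two hc hab) fun P hP => l.isSingular hX (by omega) hP

end EdgeLabelling

end PeriodicPolyhedralSurface

/-! ### Surfaces made of hexagons -/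

/-- The permutation of a product that shifts the second component by `α` and multiplies the first
one by an element depending on the second one. -/
def wreath {ι G : Type*} [AddGroup ι] [Group G] (α : ι) (H : ι → G) : Perm (G × ι) where
  toFun q := (q.1 * H q.2, q.2 + α)
  invFun q := (q.1 * (H (q.2 - α))⁻¹, q.2 - α)
  left_inv q := by simp
  right_inv q := by simp

@[simp] theorem wreath_apply {ι G : Type*} [AddGroup ι] [Group G] (α : ι) (H : ι → G) (q : G × ι) :
    wreath α H q = (q.1 * H q.2, q.2 + α) := rfl

namespace PeriodicPolyhedralSurface

variable {X : PeriodicPolyhedralSurface 6} {f₀ : X.Face} {G : Type*} [Group G]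

/-- The vertices of the regular hexagon in the coordinates `hexX`, `hexY`. -/
def hexVertices : Set (ℝ × ℝ) := {(1, 0), (0, 1), (-1, 1), (-1, 0), (0, -1), (1, -1)}

theorem unitRoot_six_pow (k : ℕ) : unitRoot 6 ^ (2 * k) = unitRoot 3 ^ k := by
  rw [pow_mul, unitRoot_two_mul_pow_two 3]

theorem mem_hexVertices_iff {z : ℂ} :
    (hexX z, hexY z) ∈ hexVertices ↔ ∃ k, unitRoot 3 ^ k = z := by
  have h3 : unitRoot 3 ^ 3 = -1 := unitRoot_pow_self
  constructor
  · have key (k : ℕ) (hx : hexX z = hexX (unitRoot 3 ^ k)) (hy : hexY z = hexY (unitRoot 3 ^ k)) :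
        ∃ k, unitRoot 3 ^ k = z :=
      ⟨k, (sub_eq_zero.1 (eq_zero_of_hex (by rw [map_sub, hx, sub_self])
        (by rw [map_sub, hy, sub_self]))).symm⟩
    simp only [hexVertices, mem_insert_iff, mem_singleton_iff, Prod.mk.injEq]
    rintro (⟨hx, hy⟩ | ⟨hx, hy⟩ | ⟨hx, hy⟩ | ⟨hx, hy⟩ | ⟨hx, hy⟩ | ⟨hx, hy⟩)
    · exact key 0 (by simpa) (by simpa)
    · exact key 1 (by simpa) (by simpa)
    · exact key 2 (by simpa [unitRoot_three_pow_two]) (by simpa [unitRoot_three_pow_two])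
    · exact key 3 (by simpa [h3]) (by simpa [h3])
    · exact key 4 (by simpa [pow_succ _ 3, h3]) (by simpa [pow_succ _ 3, h3])
    · exact key 5 (by simpa [pow_add _ 3 2, h3, unitRoot_three_pow_two])
        (by simpa [pow_add _ 3 2, h3, unitRoot_three_pow_two])
  · rintro ⟨k, rfl⟩
    rcases unitRoot_three_pow_mem k with ⟨-, h | h | h⟩ | ⟨-, h | h | h⟩ <;>
      rw [h] <;> simp [hexVertices]

theorem hexagonCover_exists_vertex_eq_iff (c : (X.translationCover f₀).Face) {z : ℂ} :
    (∃ i, (X.translationCover f₀).vertex c i = z) ↔ (hexX z, hexY z) ∈ hexVertices := by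
  obtain ⟨m, hm⟩ := (even_turn (by simp) (by decide) c).two_dvd
  have hvertex (i : Fin 6) : (X.translationCover f₀).vertex c i = unitRoot 3 ^ (m + i) := by
    rw [translationCover_vertex, normalIndex, hm, ← mul_add, unitRoot_six_pow]
  simp only [hvertex, mem_hexVertices_iff]
  refine ⟨fun ⟨i, hi⟩ => ⟨_, hi⟩, fun ⟨k, hk⟩ => ⟨Fin.ofNat 6 (k + 5 * m), ?_⟩⟩
  rw [← hk, unitRoot_pow_eq_iff, Nat.ModEq, Fin.val_ofNat]
  omega

theorem hexagonCover_mem_Icc {c : (X.translationCover f₀).Face} {z : ℂ}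
    (hz : z ∈ (X.translationCover f₀).polygon c) :
    hexX z ∈ Icc (-1 : ℝ) 1 ∧ hexY z ∈ Icc (-1 : ℝ) 1 ∧ (hexX + hexY) z ∈ Icc (-1 : ℝ) 1 := by
  have hconv (A : ℂ →ₗ[ℝ] ℝ) : Convex ℝ (A ⁻¹' Icc (-1) 1) := (convex_Icc _ _).linear_preimage A
  refine RegularPolygonGluing.polygon_subset ((hconv hexX).inter ((hconv hexY).inter
    (hconv (hexX + hexY)))) (fun i => ?_) hz
  have hi := (hexagonCover_exists_vertex_eq_iff c).1 ⟨i, rfl⟩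
  simp only [hexVertices, mem_insert_iff, mem_singleton_iff, Prod.mk.injEq] at hi
  rcases hi with ⟨hx, hy⟩ | ⟨hx, hy⟩ | ⟨hx, hy⟩ | ⟨hx, hy⟩ | ⟨hx, hy⟩ | ⟨hx, hy⟩ <;>
    simp [hx, hy]

namespace EdgeLabelling

variable (l : X.EdgeLabelling G)

/-- The quotient of the labels of two hexagons with a common edge that starts in the direction
`π * k / 3`, for labellings in which opposite edges of a hexagon have the same label. -/
def hexCross (k : ℕ) : G := l.R ^ k * l.E * (l.R ^ k)⁻¹

theorem mul_hexCross_mul_hexCross (g : G) (k : ℕ) : g * l.hexCross k * l.hexCross k = g := by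
  calc _ = g * l.R ^ k * (l.E * l.E) * (l.R ^ k)⁻¹ := by rw [hexCross]; group
    _ = g := by rw [l.E_mul_E]; group

theorem placed_eq_mul_hexCross (hR : l.R ^ 3 = 1) {c c' : X.PlacedFace} {k : ℕ}
    (h : GluedAt c c' (2 * k)) : l.placed c' = l.placed c * l.hexCross k := by
  rw [l.placed_eq_of_gluedAt (q := 3) rfl h, pow_add, hR, hexCross]
  group

/-- The permutation to the right of the unit squares that correspond to the three rhombi of each
hexagon. -/
def hexRight : Perm (G × ZMod 3) := wreath 2 ![l.hexCross 0, 1, l.hexCross 2]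

/-- The permutation upwards of the unit squares that correspond to the three rhombi of each
hexagon. -/
def hexUp : Perm (G × ZMod 3) := wreath 1 ![l.hexCross 0, l.hexCross 1, 1]

/-- The loop around the corner of a unit square. -/
def hexLoop : Perm (G × ZMod 3) := l.hexUp * l.hexRight * l.hexUp⁻¹ * l.hexRight⁻¹

theorem hexLoop_apply_zero (g : G) : l.hexLoop (g, 0) = (g, 0) := by
  have hright : l.hexRight⁻¹ (g, 0) = (g, 1) := Perm.inv_eq_iff_eq.2 (Prod.ext (mul_one g).symm rfl)
  have hup : l.hexUp⁻¹ (g, 1) = (g * l.hexCross 0, 0) :=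
    Perm.inv_eq_iff_eq.2 (Prod.ext (l.mul_hexCross_mul_hexCross g 0).symm rfl)
  have hright' : l.hexRight (g * l.hexCross 0, 0) = (g, 2) :=
    Prod.ext (l.mul_hexCross_mul_hexCross g 0) rfl
  have hup' : l.hexUp (g, 2) = (g, 0) := Prod.ext (mul_one g) rfl
  rw [hexLoop, Perm.mul_apply, Perm.mul_apply, Perm.mul_apply, hright, hup, hright', hup']

/-- The chart in which the three unit squares that correspond to the rhombi of a hexagon are
numbered by its label and an element of `ZMod 3`. -/
def hexChart : SquareChart (Set (G × ZMod 3) × UnitAddCircle × UnitAddCircle) l.hexLoop :=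
  SquareChart.ofPerms l.hexRight l.hexUp

theorem hexChart_right_zero (g : G) {s : ℝ} (hs : s ∈ Icc (0 : ℝ) 1) :
    l.hexChart.cell (g, 0) 1 s = l.hexChart.cell (g * l.hexCross 0, 2) 0 s :=
  l.hexChart.cell_right (g, 0) s hs

theorem hexChart_right_one (g : G) {s : ℝ} (hs : s ∈ Icc (0 : ℝ) 1) :
    l.hexChart.cell (g, 1) 1 s = l.hexChart.cell (g, 0) 0 s :=
  (l.hexChart.cell_right (g, 1) s hs).trans
    (congrArg (l.hexChart.cell · 0 s) (Prod.ext (mul_one g) rfl))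

theorem hexChart_right_two (g : G) {s : ℝ} (hs : s ∈ Icc (0 : ℝ) 1) :
    l.hexChart.cell (g, 2) 1 s = l.hexChart.cell (g * l.hexCross 2, 1) 0 s :=
  l.hexChart.cell_right (g, 2) s hs

theorem hexChart_up_zero (g : G) {s : ℝ} (hs : s ∈ Icc (0 : ℝ) 1) :
    l.hexChart.cell (g, 0) s 1 = l.hexChart.cell (g * l.hexCross 0, 1) s 0 :=
  l.hexChart.cell_up (g, 0) s hs

theorem hexChart_up_one (g : G) {s : ℝ} (hs : s ∈ Icc (0 : ℝ) 1) :
    l.hexChart.cell (g, 1) s 1 = l.hexChart.cell (g * l.hexCross 1, 2) s 0 :=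
  l.hexChart.cell_up (g, 1) s hs

theorem hexChart_up_two (g : G) {s : ℝ} (hs : s ∈ Icc (0 : ℝ) 1) :
    l.hexChart.cell (g, 2) s 1 = l.hexChart.cell (g, 0) s 0 :=
  (l.hexChart.cell_up (g, 2) s hs).trans
    (congrArg (l.hexChart.cell · s 0) (Prod.ext (mul_one g) rfl))

/-- The point with the coordinates `hexX = a`, `hexY = b` in the hexagon with the label `g`. The
rhombi with the indices `0`, `1`, `2` have an acute corner, an obtuse corner, and an obtuse corner
at the centre. The first one is cut by an edge, so that the part with `a, b < 0` of the
hexagon belongs to the rhombus with index `0` of the neighbour across the opposite edge. -/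
def hexCell (g : G) (a b : ℝ) : Set (G × ZMod 3) × UnitAddCircle × UnitAddCircle :=
  if 0 ≤ a then
    if 0 ≤ b then l.hexChart.cell (g, 0) a b else l.hexChart.cell (g, 2) a (b + 1)
  else
    if 0 ≤ b then l.hexChart.cell (g, 1) (a + 1) b
    else l.hexChart.cell (g * l.hexCross 0, 0) (a + 1) (b + 1)

variable {a b : ℝ} (g : G)

theorem hexCell_of_nonneg_of_nonneg (ha : 0 ≤ a) (hb : 0 ≤ b) :
    l.hexCell g a b = l.hexChart.cell (g, 0) a b := by
  rw [hexCell, if_pos ha, if_pos hb]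

theorem hexCell_of_nonneg_of_nonpos (ha : a ∈ Icc (0 : ℝ) 1) (hb : b ≤ 0) :
    l.hexCell g a b = l.hexChart.cell (g, 2) a (b + 1) := by
  rcases hb.lt_or_eq with hb | rfl
  · rw [hexCell, if_pos ha.1, if_neg hb.not_ge]
  · rw [hexCell, if_pos ha.1, if_pos le_rfl, zero_add, l.hexChart_up_two g ha]

theorem hexCell_of_nonpos_of_nonneg (ha : a ≤ 0) (hb : b ∈ Icc (0 : ℝ) 1) :
    l.hexCell g a b = l.hexChart.cell (g, 1) (a + 1) b := by
  rcases ha.lt_or_eq with ha | rfl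
  · rw [hexCell, if_neg ha.not_ge, if_pos hb.1]
  · rw [hexCell, if_pos le_rfl, if_pos hb.1, zero_add, l.hexChart_right_one g hb]

theorem hexCell_of_nonpos_of_nonpos (ha : a ∈ Icc (-1 : ℝ) 0) (hb : b ∈ Icc (-1 : ℝ) 0) :
    l.hexCell g a b = l.hexChart.cell (g * l.hexCross 0, 0) (a + 1) (b + 1) := by
  rcases ha.2.lt_or_eq with ha' | rfl
  · rcases hb.2.lt_or_eq with hb' | rfl
    · rw [hexCell, if_neg ha'.not_ge, if_neg hb'.not_ge]
    · rw [l.hexCell_of_nonpos_of_nonneg g ha.2 (by simp), zero_add,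
        l.hexChart_up_zero _ ⟨by linarith [ha.1], by linarith⟩, l.mul_hexCross_mul_hexCross]
  · rw [l.hexCell_of_nonneg_of_nonpos g (by simp) hb.2, zero_add,
      l.hexChart_right_zero _ ⟨by linarith [hb.1], by linarith [hb.2]⟩,
      l.mul_hexCross_mul_hexCross]

theorem exists_hexCell_eq (ha : a ∈ Icc (-1 : ℝ) 1) (hb : b ∈ Icc (-1 : ℝ) 1) :
    ∃ q, ∃ m n : ℤ, a + m ∈ Icc (0 : ℝ) 1 ∧ b + n ∈ Icc (0 : ℝ) 1 ∧
      l.hexCell g a b = l.hexChart.cell q (a + m) (b + n) := by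
  obtain ⟨ha₁, ha₂⟩ := ha
  obtain ⟨hb₁, hb₂⟩ := hb
  rcases le_total 0 a with ha | ha <;> rcases le_total 0 b with hb | hb
  · exact ⟨(g, 0), 0, 0, by simp [*], by simp [*],
      by simp [l.hexCell_of_nonneg_of_nonneg g ha hb]⟩
  · exact ⟨(g, 2), 0, 1, by simp [*], by constructor <;> push_cast <;> linarith,
      by simp [l.hexCell_of_nonneg_of_nonpos g ⟨ha, ha₂⟩ hb]⟩
  · exact ⟨(g, 1), 1, 0, by constructor <;> push_cast <;> linarith, by simp [*],
      by simp [l.hexCell_of_nonpos_of_nonneg g ha ⟨hb, hb₂⟩]⟩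
  · exact ⟨(g * l.hexCross 0, 0), 1, 1, by constructor <;> push_cast <;> linarith,
      by constructor <;> push_cast <;> linarith,
      by simp [l.hexCell_of_nonpos_of_nonpos g ⟨ha₁, ha⟩ ⟨hb₁, hb⟩]⟩

theorem hexCell_edge_zero {t : ℝ} (ht : t ∈ Icc (0 : ℝ) 1) :
    l.hexCell g (1 - t) t = l.hexCell (g * l.hexCross 0) (-t) (t - 1) := by
  rw [l.hexCell_of_nonneg_of_nonneg g (by linarith [ht.2]) ht.1,
    l.hexCell_of_nonpos_of_nonpos _ ⟨by linarith [ht.2], by linarith [ht.1]⟩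
      ⟨by linarith [ht.1], by linarith [ht.2]⟩, l.mul_hexCross_mul_hexCross, sub_add_cancel,
    neg_add_eq_sub]

theorem hexCell_edge_one {t : ℝ} (ht : t ∈ Icc (0 : ℝ) 1) :
    l.hexCell g (-t) 1 = l.hexCell (g * l.hexCross 1) (1 - t) (-1) := by
  have ht' : 1 - t ∈ Icc (0 : ℝ) 1 := by simpa [and_comm] using ht
  rw [l.hexCell_of_nonpos_of_nonneg g (by linarith [ht.1]) (by simp),
    l.hexCell_of_nonneg_of_nonpos _ ht' (by norm_num), neg_add_cancel, neg_add_eq_sub,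
    l.hexChart_up_one g ht']

theorem hexCell_edge_two {t : ℝ} (ht : t ∈ Icc (0 : ℝ) 1) :
    l.hexCell g (-1) (1 - t) = l.hexCell (g * l.hexCross 2) 1 (-t) := by
  have ht' : 1 - t ∈ Icc (0 : ℝ) 1 := by simpa [and_comm] using ht
  rw [l.hexCell_of_nonpos_of_nonneg g (by norm_num) ht',
    l.hexCell_of_nonneg_of_nonpos _ (by simp) (by linarith [ht.1]), neg_add_cancel, neg_add_eq_sub,
    l.hexChart_right_two _ ht', l.mul_hexCross_mul_hexCross]

theorem hexCell_ray {x y : ℝ} (hx : ∀ᶠ s in 𝓝[≥] (0 : ℝ), x + s * a ∈ Icc (-1 : ℝ) 1)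
    (hy : ∀ᶠ s in 𝓝[≥] (0 : ℝ), y + s * b ∈ Icc (-1 : ℝ) 1) :
    l.hexChart.Ray (fun s => l.hexCell g (x + s * a) (y + s * b)) a b := by
  rcases eventually_affine_nonneg_or_nonpos x a with ha | ha <;>
    rcases eventually_affine_nonneg_or_nonpos y b with hb | hb
  · refine ⟨(g, 0), x, y, ?_⟩
    filter_upwards [hx, hy, ha, hb] with s hx hy ha hb
    exact ⟨⟨ha, hx.2⟩, ⟨hb, hy.2⟩, l.hexCell_of_nonneg_of_nonneg g ha hb⟩
  · refine ⟨(g, 2), x, y + 1, ?_⟩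
    filter_upwards [hx, hy, ha, hb] with s hx hy ha hb
    rw [add_right_comm y]
    exact ⟨⟨ha, hx.2⟩, ⟨by linarith [hy.1], by linarith⟩,
      l.hexCell_of_nonneg_of_nonpos g ⟨ha, hx.2⟩ hb⟩
  · refine ⟨(g, 1), x + 1, y, ?_⟩
    filter_upwards [hx, hy, ha, hb] with s hx hy ha hb
    rw [add_right_comm x]
    exact ⟨⟨by linarith [hx.1], by linarith⟩, ⟨hb, hy.2⟩,
      l.hexCell_of_nonpos_of_nonneg g ha ⟨hb, hy.2⟩⟩
  · refine ⟨(g * l.hexCross 0, 0), x + 1, y + 1, ?_⟩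
    filter_upwards [hx, hy, ha, hb] with s hx hy ha hb
    rw [add_right_comm x, add_right_comm y]
    exact ⟨⟨by linarith [hx.1], by linarith⟩, ⟨by linarith [hy.1], by linarith⟩,
      l.hexCell_of_nonpos_of_nonpos g ⟨hx.1, ha⟩ ⟨hy.1, hb⟩⟩

theorem exists_hexCell_eq_corner (h : (a, b) ∈ hexVertices) :
    ∃ q : G × ZMod 3, q.2 ≠ 0 ∧ l.hexCell g a b = l.hexChart.cell q 0 0 := by
  have h0 : (0 : ℝ) ∈ Icc (0 : ℝ) 1 := by simp
  have h1 : (1 : ℝ) ∈ Icc (0 : ℝ) 1 := by simp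
  have one_ne : (1 : ZMod 3) ≠ 0 := by decide
  have two_ne : (2 : ZMod 3) ≠ 0 := by decide
  simp only [hexVertices, mem_insert_iff, mem_singleton_iff, Prod.mk.injEq] at h
  rcases h with ⟨rfl, rfl⟩ | ⟨rfl, rfl⟩ | ⟨rfl, rfl⟩ | ⟨rfl, rfl⟩ | ⟨rfl, rfl⟩ | ⟨rfl, rfl⟩
  · rw [l.hexCell_of_nonneg_of_nonneg g h1.1 le_rfl, l.hexChart_right_zero g h0]
    exact ⟨_, two_ne, rfl⟩
  · rw [l.hexCell_of_nonneg_of_nonneg g le_rfl h1.1, l.hexChart_up_zero g h0]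
    exact ⟨_, one_ne, rfl⟩
  · rw [l.hexCell_of_nonpos_of_nonneg g (by norm_num) h1, neg_add_cancel, l.hexChart_up_one g h0]
    exact ⟨_, two_ne, rfl⟩
  · rw [l.hexCell_of_nonpos_of_nonneg g (by norm_num) h0, neg_add_cancel]
    exact ⟨_, one_ne, rfl⟩
  · rw [l.hexCell_of_nonneg_of_nonpos g h0 (by norm_num), neg_add_cancel]
    exact ⟨_, two_ne, rfl⟩
  · rw [l.hexCell_of_nonneg_of_nonpos g h1 (by norm_num), neg_add_cancel,
      l.hexChart_right_two g h0]
    exact ⟨_, one_ne, rfl⟩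

variable {g}

theorem exists_int_of_hexCell_eq_corner (ha : a ∈ Icc (-1 : ℝ) 1) (hb : b ∈ Icc (-1 : ℝ) 1)
    {q : G × ZMod 3} (h : l.hexCell g a b = l.hexChart.cell q 0 0) :
    (a = -1 ∨ a = 0 ∨ a = 1) ∧ (b = -1 ∨ b = 0 ∨ b = 1) := by
  have of_int {x : ℝ} (hx : x ∈ Icc (-1 : ℝ) 1) {m k : ℤ} (hm : x + m = 0 + k) :
      x = -1 ∨ x = 0 ∨ x = 1 := by
    obtain rfl : x = ((k - m : ℤ) : ℝ) := by push_cast; linarith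
    obtain ⟨h₁, h₂⟩ : -1 ≤ k - m ∧ k - m ≤ 1 := ⟨mod_cast hx.1, mod_cast hx.2⟩
    interval_cases k - m <;> simp
  obtain ⟨q', m, n, hm, hn, heq⟩ := l.exists_hexCell_eq g ha hb
  have hpos : torusPoint (a + m) (b + n) = torusPoint 0 0 := by
    rw [← l.hexChart.pos_cell q' _ hm _ hn, ← heq, h, l.hexChart.pos_cell_zero, torusPoint_zero]
  obtain ⟨⟨i, hi⟩, j, hj⟩ := torusPoint_eq_iff.1 hpos
  exact ⟨of_int ha hi, of_int hb hj⟩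

theorem hexCell_eq_corner_iff (ha : a ∈ Icc (-1 : ℝ) 1) (hb : b ∈ Icc (-1 : ℝ) 1)
    (hab : a + b ∈ Icc (-1 : ℝ) 1) :
    (∃ q : G × ZMod 3, q.2 ≠ 0 ∧ l.hexCell g a b = l.hexChart.cell q 0 0) ↔
      (a, b) ∈ hexVertices := by
  refine ⟨fun ⟨q, hq, h⟩ => ?_, l.exists_hexCell_eq_corner g⟩
  have hcentre : ¬ (a = 0 ∧ b = 0) := by
    rintro ⟨rfl, rfl⟩
    rw [l.hexCell_of_nonneg_of_nonneg g le_rfl le_rfl] at h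
    rw [← (l.hexChart.corner _ _ h).eq_of_left (l.hexLoop_apply_zero g)] at hq
    exact hq rfl
  obtain ⟨rfl | rfl | rfl, rfl | rfl | rfl⟩ := l.exists_int_of_hexCell_eq_corner ha hb h <;>
    revert hab hcentre <;> norm_num [hexVertices]

/-- The map of the translation cover that cuts each hexagon into three rhombi. -/
def hexModel (hR : l.R ^ 3 = 1) (f₀ : X.Face) :
    (X.translationCover f₀).SquareModel l.hexChart {q | q.2 ≠ 0} where
  develop c z := l.hexCell (l.placed c.1) (hexX z) (hexY z)
  linX := hexX
  linY := hexY
  eq_zero_of_lin _ := eq_zero_of_hex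
  develop_eq x y hxy := by
    refine develop_eq_of_identified (by simp)
      (develop := fun c z => l.hexCell (l.placed c.1) (hexX z) (hexY z))
      (fun c c' r hr h t ht => ?_) hxy
    obtain ⟨k, rfl⟩ := ((h.even_iff (by decide)).1.1 (even_turn (by simp) (by decide) c)).two_dvd
    have h3 : unitRoot 3 ^ 3 = -1 := unitRoot_pow_self
    rw [map_neg, map_neg, map_edgePoint, map_edgePoint, map_edgePoint, map_edgePoint,
      ← mul_add_one 2 k, unitRoot_six_pow, unitRoot_six_pow, l.placed_eq_mul_hexCross hR h]
    have hk : k < 3 := by omega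
    interval_cases k
    · convert l.hexCell_edge_zero (l.placed c.1) ht using 2 <;> simp
    · convert l.hexCell_edge_one (l.placed c.1) ht using 2 <;> simp [unitRoot_three_pow_two]
    · convert l.hexCell_edge_two (l.placed c.1) ht using 2
      all_goals simp [unitRoot_three_pow_two, h3]
      ring
  ray c x z h := by
    simp only [map_add, ← Complex.real_smul, map_smul, smul_eq_mul]
    refine l.hexCell_ray _ (h.mono fun s hs => ?_) (h.mono fun s hs => ?_)
    · simpa [← Complex.real_smul] using (hexagonCover_mem_Icc hs).1
    · simpa [← Complex.real_smul] using (hexagonCover_mem_Icc hs).2.1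
  vertex_iff c x hx := by
    obtain ⟨ha, hb, hab⟩ := hexagonCover_mem_Icc hx
    exact (hexagonCover_exists_vertex_eq_iff c).trans (l.hexCell_eq_corner_iff ha hb hab).symm

theorem not_exists_isClosedSaddleConnection_of_hexagons [Finite X.Face] (hX : X.IsClosedSurface)
    (hR : l.R ^ 3 = 1) {G' : Type*} [Group G'] (l' : X.EdgeLabelling G')
    (hl : 3 < orderOf l'.cornerTurn) {P : Perm (G × ZMod 3) → Perm (G × ZMod 3) → Prop}
    (hP : MoveInvariant P) (hret : ∀ h v, P h v → NoReturn l.hexLoop {q | q.2 ≠ 0} h)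
    (hC : P l.hexRight l.hexUp) : ¬ ∃ γ, (X.translationCover f₀).IsClosedSaddleConnection γ := by
  refine (l.hexModel hR f₀).not_exists_isClosedSaddleConnection hP (fun ⟨g, i⟩ hq => ?_) hret hC
    fun Q hQ => l'.isSingular hX (by omega) hQ
  obtain rfl : i = 0 := by simpa using hq
  exact l.hexLoop_apply_zero g

end EdgeLabelling

end PeriodicPolyhedralSurface

/-! ### Three orbits of translations -/

theorem MoveInvariant.and {Q : Type*} {P P' : Perm Q → Perm Q → Prop} (hP : MoveInvariant P)
    (hP' : MoveInvariant P') : MoveInvariant fun h v => P h v ∧ P' h v where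
  shear h v hhv := ⟨hP.shear h v hhv.1, hP'.shear h v hhv.2⟩
  quarterTurn h v hhv := ⟨hP.quarterTurn h v hhv.1, hP'.quarterTurn h v hhv.2⟩

theorem moveInvariant_commutator_eq {Q : Type*} (c : Perm Q) :
    MoveInvariant fun h v => v * h * v⁻¹ * h⁻¹ = c where
  shear h v hc := by rw [← hc]; group
  quarterTurn h v hc := by rw [← hc]; group

section Shift

variable {ι G : Type*} [AddCommGroup ι] [Group G]

theorem wreath_zero_zpow_apply (K : ι → G) (k : ℤ) (q : G × ι) :
    (wreath 0 K ^ k) q = (q.1 * K q.2 ^ k, q.2) := by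
  have hpow (n : ℕ) (q : G × ι) : (wreath 0 K ^ n) q = (q.1 * K q.2 ^ n, q.2) := by
    induction n with
    | zero => simp
    | succ n ih => simp [pow_succ', ih, mul_assoc, (Commute.pow_self (K q.2) n).eq]
  cases k with
  | ofNat n => simpa using hpow n q
  | negSucc n => exact Perm.inv_eq_iff_eq.2 (by simp [hpow])

theorem sameCycle_wreath_zero {K : ι → G} {q q' : G × ι} (hq : (wreath 0 K).SameCycle q q') :
    ∃ k : ℤ, q' = (q.1 * K q.2 ^ k, q.2) := by
  obtain ⟨k, rfl⟩ := hq
  exact ⟨k, wreath_zero_zpow_apply K k q⟩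

theorem wreath_mul_eq_of_commutator {β : ι} {H V K : ι → G}
    (hc : wreath β V * wreath 0 H * (wreath β V)⁻¹ * (wreath 0 H)⁻¹ = wreath 0 K) (i : ι) :
    H i * V i = V i * H (i + β) * K (i + β) := by
  have hmul : wreath β V * wreath 0 H = wreath 0 K * (wreath 0 H * wreath β V) := by
    rw [← hc]; group
  simpa using congrArg Prod.fst (Equiv.congr_fun hmul (1, i))

/-- `h` is a map `wreath` with shift `α`, and the product of the images under `χ` of its
multipliers is trivial. -/
def IsShift {ι G A : Type*} [AddGroup ι] [Fintype ι] [Group G] [CommGroup A] (χ : G →* A) (α : ι)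
    (h : Perm (G × ι)) : Prop :=
  ∃ H : ι → G, h = wreath α H ∧ ∏ i, χ (H i) = 1

variable [Fintype ι] {A : Type*} [CommGroup A] {χ : G →* A} {α β : ι} {h v : Perm (G × ι)}

theorem IsShift.mul (hh : IsShift χ α h) (hv : IsShift χ β v) : IsShift χ (β + α) (h * v) := by
  obtain ⟨H, rfl, hH⟩ := hh
  obtain ⟨V, rfl, hV⟩ := hv
  refine ⟨fun i => V i * H (i + β), by ext q <;> simp [mul_assoc, add_assoc], ?_⟩
  simp only [map_mul, Finset.prod_mul_distrib, hV, one_mul]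
  rw [← hH]
  exact Equiv.prod_comp (Equiv.addRight β) fun i => χ (H i)

theorem IsShift.inv (hh : IsShift χ α h) : IsShift χ (-α) h⁻¹ := by
  obtain ⟨H, rfl, hH⟩ := hh
  refine ⟨fun i => (H (i - α))⁻¹, Equiv.ext fun q => ?_, ?_⟩
  · exact Perm.inv_eq_iff_eq.2 (by simp [← sub_eq_add_neg])
  · simp only [map_inv, Finset.prod_inv_distrib, inv_eq_one]
    rw [← hH]
    exact Equiv.prod_comp (Equiv.subRight α) fun i => χ (H i)

theorem moveInvariant_isShift (χ : G →* A) : MoveInvariant fun h v : Perm (G × ι) =>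
    ∃ α β, (α ≠ 0 ∨ β ≠ 0) ∧ IsShift χ α h ∧ IsShift χ β v where
  shear h v := by
    rintro ⟨α, β, hαβ, hh, hv⟩
    refine ⟨α, α + β, ?_, hh, hv.mul hh⟩
    contrapose! hαβ
    simpa [hαβ.1] using hαβ
  quarterTurn h v := by
    rintro ⟨α, β, hαβ, hh, hv⟩
    exact ⟨-α + (β + α), -α, by simpa [or_comm] using hαβ, (hh.mul hv).mul hh.inv, hh.inv⟩

end Shift

section ThreeOrbits

variable {G A : Type*} [Group G] [CommGroup A] {χ : G →* A} {h v : Perm (G × ZMod 3)} {α β : ZMod 3}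

theorem noReturn_of_isShift {K : ZMod 3 → G} (hh : IsShift χ α h)
    (hret : ∀ q : G × ZMod 3, q.2 ≠ 0 → α = 0 → ¬ (wreath 0 K).SameCycle q (h q)) :
    NoReturn (wreath 0 K) {q | q.2 ≠ 0} h := by
  have snd_eq {q q' : G × ZMod 3} (hq : (wreath 0 K).SameCycle q q') : q'.2 = q.2 := by
    obtain ⟨k, rfl⟩ := sameCycle_wreath_zero hq
    rfl
  have two_steps : ∀ α i : ZMod 3, i ≠ 0 → i + α = 0 → i + α + α ≠ 0 ∧ i + α + α ≠ i := by
    decide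
  obtain ⟨H, rfl, -⟩ := hh
  refine fun q hq => ⟨fun _ hs => hret q hq (by simpa using snd_eq hs) hs, fun hn => ?_⟩
  obtain ⟨h0, hne⟩ := two_steps α q.2 hq (by simpa using hn)
  exact ⟨h0, fun hs => hne (snd_eq hs)⟩

/-- Commuting permutations whose cubes are two different involutions. -/
def CommuteWithCubesNe {Q : Type*} (h v : Perm Q) : Prop :=
  Commute h v ∧ h ^ 6 = 1 ∧ v ^ 6 = 1 ∧ h ^ 3 ≠ 1 ∧ v ^ 3 ≠ 1 ∧ h ^ 3 ≠ v ^ 3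

theorem moveInvariant_commuteWithCubesNe {Q : Type*} :
    MoveInvariant (CommuteWithCubesNe (Q := Q)) where
  shear := by
    rintro h v ⟨hc, h6, v6, h3, v3, hv⟩
    have h3inv : h ^ 3 = (h ^ 3)⁻¹ := by rw [eq_inv_iff_mul_eq_one, ← pow_add, h6]
    refine ⟨hc.mul_right (Commute.refl h), h6, ?_, h3, ?_, ?_⟩
    · rw [hc.symm.mul_pow, h6, v6, one_mul]
    · rw [hc.symm.mul_pow, Ne, mul_eq_one_iff_eq_inv, ← h3inv]
      exact hv.symm
    · rw [hc.symm.mul_pow]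
      exact fun h => v3 (mul_eq_right.1 h.symm)
  quarterTurn := by
    rintro h v ⟨hc, h6, v6, h3, v3, hv⟩
    have h3inv : h ^ 3 = (h ^ 3)⁻¹ := by rw [eq_inv_iff_mul_eq_one, ← pow_add, h6]
    rw [hc.eq, mul_inv_cancel_right]
    refine ⟨hc.symm.inv_right, v6, by rw [inv_pow, h6, inv_one], v3, ?_, ?_⟩
    · rwa [inv_pow, ← h3inv]
    · rw [inv_pow, ← h3inv]
      exact hv.symm

theorem noReturn_of_commute (hh : IsShift χ α h) (hv : IsShift χ β v) (hαβ : α ≠ 0 ∨ β ≠ 0)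
    (hc : Commute h v) (h1 : h ≠ 1) : NoReturn (wreath 0 1) {q | q.2 ≠ 0} h := by
  refine noReturn_of_isShift hh fun q _ hα hs => h1 ?_
  obtain ⟨H, rfl, -⟩ := hh
  obtain ⟨V, rfl, -⟩ := hv
  subst hα
  have hβ : β ≠ 0 := hαβ.resolve_left (not_not.2 rfl)
  have hcomm := wreath_mul_eq_of_commutator (K := 1) (β := β) (V := V) (H := H) (by
    rw [hc.eq.symm, mul_inv_cancel_right, mul_inv_cancel]
    ext <;> simp)
  have hstep {i : ZMod 3} (hi : H i = 1) : H (i + β) = 1 := by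
    simpa [hi] using hcomm i
  have hq : H q.2 = 1 := by
    obtain ⟨k, hk⟩ := sameCycle_wreath_zero hs
    simpa using congrArg Prod.fst hk
  have cover : ∀ β : ZMod 3, β ≠ 0 → ∀ i j, i = j ∨ i = j + β ∨ i = j + β + β := by decide
  ext p
  · rcases cover β hβ p.2 q.2 with hp | hp | hp <;> simp [hp, hq, hstep]
  · simp

/-- There is a map that conjugates both gluing permutations to their inverses and maps the squares
in `S` as the half turn around their lower left corners. -/
def HasHalfTurn {Q : Type*} (S : Set Q) (h v : Perm Q) : Prop :=
  ∃ ρ : Q → Q, (∀ q, ρ (h q) = h⁻¹ (ρ q)) ∧ (∀ q, ρ (v q) = v⁻¹ (ρ q)) ∧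
    ∀ q ∈ S, ρ q = h⁻¹ (v⁻¹ q)

theorem moveInvariant_hasHalfTurn {Q : Type*} (S : Set Q) : MoveInvariant (HasHalfTurn S) where
  shear := by
    rintro h v ⟨ρ, hh, hv, hS⟩
    refine ⟨fun q => h⁻¹ (ρ q), fun q => congrArg _ (hh q), fun q => ?_, fun q hq => ?_⟩
    · simp only [Perm.mul_apply, hv, hh, mul_inv_rev]
    · simp only [hS q hq, mul_inv_rev, Perm.mul_apply]
  quarterTurn := by
    rintro h v ⟨ρ, hh, hv, hS⟩
    have hh' (q) : ρ (h⁻¹ q) = h (ρ q) := by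
      rw [← Perm.inv_eq_iff_eq, ← hh, Perm.coe_inv, h.apply_symm_apply]
    refine ⟨fun q => h (h (ρ q)), fun q => ?_, fun q => by simp only [hh', inv_inv],
      fun q hq => ?_⟩
    · simp only [Perm.mul_apply, hh, hv, hh', mul_inv_rev, inv_inv]
      simp
    · simp [hS q hq]

theorem HasHalfTurn.apply_apply_eq {Q : Type*} {S : Set Q} {h v : Perm Q} (hρ : HasHalfTurn S h v)
    {q : Q} (hq : q ∈ S) (hhq : h q ∈ S) (hc : (v * h * v⁻¹ * h⁻¹) (h (h q)) = h (h q)) :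
    h (h q) = q := by
  obtain ⟨ρ, hh, -, hS⟩ := hρ
  have hρq : h (v⁻¹ (h q)) = v⁻¹ q := by
    rw [← Perm.eq_inv_iff_eq, ← (h⁻¹).injective.eq_iff, ← hS _ hhq, hh, hS q hq]
  calc h (h q) = v (h (v⁻¹ (h q))) := by rw [← hc]; simp
    _ = q := by rw [hρq]; simp

section Multipliers

variable {H V K : ZMod 3 → G} (hβ : β ≠ 0)
  (hc : wreath β V * wreath 0 H * (wreath β V)⁻¹ * (wreath 0 H)⁻¹ = wreath 0 K)
include hβ hc

theorem map_multiplier_zero_eq_neg_one {χ : G →* ℤˣ} (hH : ∏ i, χ (H i) = 1) (hK0 : K 0 = 1)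
    (hK : ∀ i ≠ 0, χ (K i) = -1) : χ (H 0) = -1 := by
  have hstep (i : ZMod 3) : χ (H i) = χ (H (i + β)) * χ (K (i + β)) := by
    have h := congrArg χ (wreath_mul_eq_of_commutator hc i)
    simp only [map_mul, mul_assoc] at h
    rw [mul_comm] at h
    exact mul_left_cancel h
  have prod_eq : ∀ β ≠ 0, ∀ f : ZMod 3 → ℤˣ, ∏ i, f i = f 0 * f (0 + β) * f (-β) := by
    decide +kernel
  have cube : ∀ x : ℤˣ, x * -x * x = 1 → x = -1 := by decide
  have hshift : χ (H (0 + β)) = -χ (H 0) := by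
    rw [hstep 0, hK _ (by rwa [zero_add]), mul_neg_one, neg_neg]
  have hneg : χ (H (-β)) = χ (H 0) := by
    rw [hstep, neg_add_cancel, hK0, map_one, mul_one]
  refine cube _ ?_
  rw [← hH, prod_eq β hβ, hshift, hneg]

theorem exists_multiplier_zero_eq_conj {i : ZMod 3} (hi : i ≠ 0) {k : ℤ} (hHi : H i = K i ^ k)
    (hK0 : K 0 = 1) : ∃ (u : G) (m : ℤ), H 0 = u * K i ^ m * u⁻¹ := by
  have hcomm := wreath_mul_eq_of_commutator hc
  have types : ∀ β : ZMod 3, β ≠ 0 → ∀ i ≠ 0, i = 0 + β ∨ i + β = 0 := by decide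
  rcases types β hβ i hi with h | h
  · refine ⟨V 0, k + 1, ?_⟩
    rw [eq_mul_inv_iff_mul_eq, hcomm 0, ← h, hHi, zpow_add_one, mul_assoc]
  · refine ⟨(V i)⁻¹, k, ?_⟩
    rw [← hHi, mul_assoc, inv_inv, hcomm i, h, hK0, mul_one, inv_mul_cancel_left]

end Multipliers

theorem map_zpow_eq_one_of_sq_eq_one {x : G} (hx : orderOf x = 4) (χ : G →* ℤˣ) {m : ℤ}
    (h : (x ^ m) ^ 2 = 1) : χ (x ^ m) = 1 := by
  rw [← zpow_natCast, ← zpow_mul, ← orderOf_dvd_iff_zpow_eq_one, hx] at h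
  obtain ⟨j, rfl⟩ : Even m := by
    rw [Int.even_iff]
    omega
  rw [map_zpow, zpow_add, ← mul_zpow, Int.units_mul_self, one_zpow]

theorem noReturn_of_hasHalfTurn {K : ZMod 3 → G} {χ : G →* ℤˣ} (hh : IsShift χ α h)
    (hv : IsShift χ β v) (hαβ : α ≠ 0 ∨ β ≠ 0) (hc : v * h * v⁻¹ * h⁻¹ = wreath 0 K)
    (hρ : HasHalfTurn {q | q.2 = 0} h v) (hK0 : K 0 = 1)
    (hK : ∀ i ≠ 0, orderOf (K i) = 4 ∧ χ (K i) = -1) :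
    NoReturn (wreath 0 K) {q | q.2 ≠ 0} h := by
  refine noReturn_of_isShift hh fun q hq hα hs => ?_
  obtain ⟨H, rfl, hH⟩ := hh
  obtain ⟨V, rfl, -⟩ := hv
  subst hα
  have hβ : β ≠ 0 := hαβ.resolve_left (not_not.2 rfl)
  have hH0 : H 0 * H 0 = 1 := by
    have h := hρ.apply_apply_eq (q := (1, 0)) (by simp) (by simp) (by rw [hc]; simp [hK0])
    simpa using congrArg Prod.fst h
  obtain ⟨k, hk⟩ := sameCycle_wreath_zero hs
  obtain ⟨u, m, hum⟩ := exists_multiplier_zero_eq_conj hβ hc hq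
    (mul_left_cancel (congrArg Prod.fst hk)) hK0
  have hsq : (K q.2 ^ m) ^ 2 = 1 := by
    rwa [← conj_eq_one_iff (a := u), ← conj_pow, ← hum, sq]
  have hone : χ (H 0) = 1 := by
    rw [hum, map_mul, map_mul, map_inv, map_zpow_eq_one_of_sq_eq_one (hK _ hq).1 χ hsq, mul_one,
      mul_inv_cancel]
  have hneg := map_multiplier_zero_eq_neg_one hβ hc hH hK0 fun i hi => (hK i hi).2
  exact absurd (hone.symm.trans hneg) (by decide)

end ThreeOrbits

/-! ### The five surfaces -/

open Matrix in
theorem exists_eq_sum_smul_iff_forall_dvd {ι R : Type*} [Fintype ι] [DecidableEq ι] [CommRing R]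
    [IsDomain R] {D A : Matrix ι ι R} {r : R} (hr : r ≠ 0) (hDA : D * A = r • 1) (u : ι → R) :
    (∃ m : ι → R, u = ∑ b, m b • D b) ↔ ∀ b, r ∣ (u ᵥ* A) b := by
  have hdet : A.det ≠ 0 := by
    have h := congrArg det hDA
    rw [det_mul, det_smul, det_one, mul_one] at h
    exact right_ne_zero_of_mul (h ▸ pow_ne_zero _ hr)
  have vecMul_A (m : ι → R) : (m ᵥ* D) ᵥ* A = r • m := by
    rw [vecMul_vecMul, hDA, vecMul_smul, vecMul_one]
  simp only [← vecMul_eq_sum]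
  constructor
  · rintro ⟨m, rfl⟩ b
    exact ⟨m b, congrFun (vecMul_A m) b⟩
  · intro h
    choose m hm using h
    refine ⟨m, sub_eq_zero.1 (eq_zero_of_vecMul_eq_zero hdet ?_)⟩
    rw [sub_vecMul, vecMul_A, sub_eq_zero]
    exact funext hm

namespace PeriodicPolyhedralSurface

theorem sameEdge_iff {p : ℕ} [NeZero p] {X : PeriodicPolyhedralSurface p} {M : Type*}
    [AddCommGroup M] {φ : M →+ Fin 3 → ℝ} (hφ : Function.Injective φ) {V : X.Face → Fin p → M}
    {D : Fin 3 → M} {L : M → Prop} (hV : ∀ f i, X.vertex f i = φ (V f i))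
    (hD : ∀ b, X.period b = φ (D b)) (hL : ∀ u, (∃ m : Fin 3 → ℤ, u = ∑ b, m b • D b) ↔ L u)
    (e e' : X.Face × Fin p) : X.SameEdge e e' ↔
      V e.1 (e.2 + 1) - V e'.1 e'.2 = V e.1 e.2 - V e'.1 (e'.2 + 1) ∧
        L (V e.1 e.2 - V e'.1 (e'.2 + 1)) := by
  have vertex_eq_iff (m : Fin 3 → ℤ) (i j : Fin p) :
      X.vertex e.1 i = X.vertex e'.1 j + ∑ a, (m a : ℝ) • X.period a ↔
        V e.1 i - V e'.1 j = ∑ b, m b • D b := by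
    simp only [hV, hD, Int.cast_smul_eq_zsmul, ← map_zsmul, ← map_sum, ← map_add, hφ.eq_iff,
      sub_eq_iff_eq_add']
  simp only [SameEdge, vertex_eq_iff, ← hL]
  constructor
  · rintro ⟨m, h₁, h₂⟩
    exact ⟨h₂.trans h₁.symm, m, h₁⟩
  · rintro ⟨h, m, hm⟩
    exact ⟨m, hm, h.trans hm⟩

theorem intCast_compLeft_injective :
    Function.Injective ((Int.castAddHom ℝ).compLeft (Fin 3)) :=
  Int.cast_injective.comp_left

instance : Fintype mucube.Face := inferInstanceAs (Fintype (Fin 3 × Fin 4))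

instance : DecidableRel mucube.SameEdge := fun e e' => decidable_of_iff _ <| Iff.symm <|
  sameEdge_iff (V := mucubeVertex) intCast_compLeft_injective (fun _ _ => rfl)
    (fun b => by ext a; fin_cases b <;> fin_cases a <;> simp [mucube])
    (exists_eq_sum_smul_iff_forall_dvd (D := !![2, 0, 0; 0, 2, 0; 0, 0, 2]) (A := 1) two_ne_zero
      (by decide)) e e'

theorem isClosedSurface_mucube : mucube.IsClosedSurface := by
  unfold IsClosedSurface
  decide +kernel

/-- The labels of the first edges of the faces of Mucube. -/
def mucubeLabel (f : Fin 3 × Fin 4) : Perm (Fin 4) :=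
  ![![1, c[0, 2, 3, 1], c[0, 3] * c[1, 2], c[0, 1, 3, 2]],
    ![c[0, 3, 2], c[1, 3], c[0, 2, 1], c[0, 1, 2, 3]],
    ![c[0, 2, 3], c[0, 3, 1, 2], c[1, 3, 2], c[0, 1]]] f.1 f.2

/-- A labelling of the edges of Mucube by permutations. -/
def mucubeLabelling : EdgeLabelling mucube (Perm (Fin 4)) where
  face := mucubeLabel
  R := finRotate 4
  E := swap 2 3
  R_pow := by decide +kernel
  E_mul_E := by decide +kernel
  sameEdge := by decide +kernel

theorem mucube_not_exists_isClosedSaddleConnection (f₀ : mucube.Face) :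
    ¬ ∃ γ, (mucube.translationCover f₀).IsClosedSaddleConnection γ := by
  have hcorner : 4 < orderOf mucubeLabelling.cornerTurn :=
    lt_orderOf_of_pow_ne_one fun i hi h0 => by interval_cases i <;> decide +kernel
  have horder : orderOf (c[0, 3, 2] : Perm (Fin 4)) = 3 :=
    orderOf_eq_prime (by decide +kernel) (by decide +kernel)
  refine mucubeLabelling.not_exists_isClosedSaddleConnection_of_squares isClosedSurface_mucube
    hcorner (c₀ := c[0, 3, 2]) (g := mucubeLabelling.squareRight) (by decide +kernel)
    (horder ▸ Nat.prime_three) (Subgroup.subset_closure (mem_insert _ _)) ?_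
  rw [mem_zpowers_iff_mem_range_orderOf, horder]
  decide +kernel

instance : Fintype muoctahedron.Face := inferInstanceAs (Fintype (Fin 4 ⊕ Fin 4))

instance : DecidableRel muoctahedron.SameEdge := fun e e' => decidable_of_iff _ <| Iff.symm <|
  sameEdge_iff (V := muoctahedronVertex) intCast_compLeft_injective (fun _ _ => rfl)
    (fun b => by ext a; fin_cases b <;> fin_cases a <;> simp [muoctahedron])
    (exists_eq_sum_smul_iff_forall_dvd (D := !![4, 0, 0; 0, 4, 0; 0, 0, 4]) (A := 1) four_ne_zero
      (by decide)) e e'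

theorem isClosedSurface_muoctahedron : muoctahedron.IsClosedSurface := by
  unfold IsClosedSurface
  decide +kernel

/-- The labels of the first edges of the faces of Muoctahedron. -/
def muoctahedronLabel : Fin 4 ⊕ Fin 4 → Perm (Fin 4) :=
  Sum.elim ![1, c[0, 3] * c[1, 2], c[0, 2] * c[1, 3], c[0, 1] * c[2, 3]]
    ![c[1, 3], c[0, 3, 2, 1], c[0, 2], c[0, 1, 2, 3]]

/-- A labelling of the edges of Muoctahedron by permutations. -/
def muoctahedronLabelling : EdgeLabelling muoctahedron (Perm (Fin 4)) where
  face := muoctahedronLabel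
  R := c[1, 2, 3]
  E := swap 0 1
  R_pow := by decide +kernel
  E_mul_E := by decide +kernel
  sameEdge := by decide +kernel

/-- The half turn around the centres of the hexagons of the model of Muoctahedron. -/
def muoctahedronHalfTurn (q : Perm (Fin 4) × ZMod 3) : Perm (Fin 4) × ZMod 3 :=
  (q.1 * (![muoctahedronLabelling.hexCross 0, 1, 1] : ZMod 3 → Perm (Fin 4)) q.2, -q.2)

theorem muoctahedron_hasHalfTurn :
    HasHalfTurn {q | q.2 = 0} muoctahedronLabelling.hexRight muoctahedronLabelling.hexUp :=
  ⟨muoctahedronHalfTurn, by decide +kernel, by decide +kernel, by decide +kernel⟩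

theorem muoctahedron_not_exists_isClosedSaddleConnection (f₀ : muoctahedron.Face) :
    ¬ ∃ γ, (muoctahedron.translationCover f₀).IsClosedSaddleConnection γ := by
  have hcorner : 3 < orderOf muoctahedronLabelling.cornerTurn :=
    lt_orderOf_of_pow_ne_one fun i hi h0 => by interval_cases i <;> decide +kernel
  obtain ⟨K, hK, hK0, hK_order⟩ : ∃ K : ZMod 3 → Perm (Fin 4),
      muoctahedronLabelling.hexLoop = wreath 0 K ∧ K 0 = 1 ∧
        ∀ i ≠ 0, (K i ^ 4 = 1 ∧ K i ^ 2 ≠ 1) ∧ Perm.sign (K i) = -1 := by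
    refine ⟨fun i => (muoctahedronLabelling.hexLoop (1, i)).1, ?_, ?_, ?_⟩ <;> decide +kernel
  refine muoctahedronLabelling.not_exists_isClosedSaddleConnection_of_hexagons
    isClosedSurface_muoctahedron (by decide +kernel) muoctahedronLabelling hcorner
    ((moveInvariant_isShift Perm.sign).and ((moveInvariant_commutator_eq (wreath 0 K)).and
      (moveInvariant_hasHalfTurn {q | q.2 = 0})))
    (fun h v ⟨⟨α, β, hαβ, hh, hv⟩, hc, hρ⟩ => hK ▸ noReturn_of_hasHalfTurn hh hv hαβ hc hρ hK0
      fun i hi => ⟨orderOf_eq_prime_pow (p := 2) (n := 1) (hK_order i hi).1.2 (hK_order i hi).1.1,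
        (hK_order i hi).2⟩)
    ⟨⟨2, 1, ?_, ⟨_, rfl, ?_⟩, ⟨_, rfl, ?_⟩⟩, hK, muoctahedron_hasHalfTurn⟩
  all_goals decide +kernel

instance : Fintype mutetrahedron.Face := inferInstanceAs (Fintype (Fin 4))

instance : DecidableRel mutetrahedron.SameEdge := fun e e' => decidable_of_iff _ <| Iff.symm <|
  sameEdge_iff (V := fun d i => tetraSign d * truncatedHexagon i) intCast_compLeft_injective
    (fun _ _ => rfl)
    (fun b => by ext a; fin_cases b <;> fin_cases a <;> simp [mutetrahedron])
    (exists_eq_sum_smul_iff_forall_dvd (D := !![0, 4, 4; 4, 0, 4; 4, 4, 0])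
      (A := !![-1, 1, 1; 1, -1, 1; 1, 1, -1]) (r := 8) (by decide) (by decide)) e e'

theorem isClosedSurface_mutetrahedron : mutetrahedron.IsClosedSurface := by
  unfold IsClosedSurface
  decide +kernel

/-- A labelling of the edges of Mutetrahedron by permutations. -/
def mutetrahedronLabelling : EdgeLabelling mutetrahedron (Perm (Fin 4)) where
  face := ![1, c[0, 3] * c[1, 2], c[0, 1] * c[2, 3], c[0, 2] * c[1, 3]]
  R := c[1, 2, 3]
  E := swap 0 1 * swap 2 3
  R_pow := by decide +kernel
  E_mul_E := by decide +kernel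
  sameEdge := by decide +kernel

/-- The labelling of the edges of Mutetrahedron by the parity of their numbers. -/
def mutetrahedronParity : EdgeLabelling mutetrahedron ℤˣ where
  face _ := 1
  R := -1
  E := 1
  R_pow := by decide +kernel
  E_mul_E := by decide +kernel
  sameEdge := by decide +kernel

theorem mutetrahedron_not_exists_isClosedSaddleConnection (f₀ : mutetrahedron.Face) :
    ¬ ∃ γ, (mutetrahedron.translationCover f₀).IsClosedSaddleConnection γ := by
  have hcorner : 3 < orderOf mutetrahedronParity.cornerTurn :=
    lt_orderOf_of_pow_ne_one fun i hi h0 => by interval_cases i <;> decide +kernel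
  have hloop : mutetrahedronLabelling.hexLoop = wreath 0 1 := by decide +kernel
  refine mutetrahedronLabelling.not_exists_isClosedSaddleConnection_of_hexagons
    isClosedSurface_mutetrahedron (by decide +kernel) mutetrahedronParity hcorner
    ((moveInvariant_isShift (1 : Perm (Fin 4) →* ℤˣ)).and moveInvariant_commuteWithCubesNe)
    (fun h v ⟨⟨α, β, hαβ, hh, hv⟩, hcomm, _, _, hh3, _⟩ => hloop ▸
      noReturn_of_commute hh hv hαβ hcomm fun h1 => hh3 (by rw [h1, one_pow]))
    ⟨⟨2, 1, by decide, ⟨_, rfl, by simp⟩, ⟨_, rfl, by simp⟩⟩, (?_ : _ * _ = _ * _),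
      ?_, ?_, ?_, ?_, ?_⟩
  all_goals decide +kernel

instance : Fintype octa4.Face :=
  inferInstanceAs (Fintype ((Fin 4 × Fin 3 ⊕ Fin 4 × Fin 3) ⊕ (Fin 4 ⊕ Fin 4)))

instance : DecidableRel octa4.SameEdge := fun e e' => decidable_of_iff _ <| Iff.symm <|
  sameEdge_iff (V := octa4Vertex) intCast_compLeft_injective (fun _ _ => rfl)
    (fun b => by ext a; fin_cases b <;> fin_cases a <;> simp [octa4])
    (exists_eq_sum_smul_iff_forall_dvd (D := !![0, 8, 8; 8, 0, 8; 8, 8, 0])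
      (A := !![-1, 1, 1; 1, -1, 1; 1, 1, -1]) (r := 16) (by decide) (by decide)) e e'

theorem isClosedSurface_octa4 : octa4.IsClosedSurface := by
  unfold IsClosedSurface
  decide +kernel

/-- The labels of the first edges of the faces of Octa-4. -/
def octa4Label : (Fin 4 × Fin 3 ⊕ Fin 4 × Fin 3) ⊕ (Fin 4 ⊕ Fin 4) → Perm (Fin 4) :=
  Sum.elim
    (Sum.elim (fun f => ![1, c[0, 3, 2], c[0, 2, 3]] f.2)
      (fun f => ![c[2, 3], c[0, 3], c[0, 2]] f.2))
    (Sum.elim (fun _ => c[0, 1, 3, 2]) (fun _ => c[0, 1, 2]))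

/-- A labelling of the edges of Octa-4 by permutations. -/
def octa4Labelling : EdgeLabelling octa4 (Perm (Fin 4)) where
  face := octa4Label
  R := c[1, 2, 3]
  E := swap 0 1
  R_pow := by decide +kernel
  E_mul_E := by decide +kernel
  sameEdge := by decide +kernel

theorem octa4_not_exists_isClosedSaddleConnection (f₀ : octa4.Face) :
    ¬ ∃ γ, (octa4.translationCover f₀).IsClosedSaddleConnection γ := by
  have hcorner : 6 < orderOf octa4Labelling.cornerTurn :=
    lt_orderOf_of_pow_ne_one fun i hi h0 => by interval_cases i <;> decide +kernel
  exact octa4Labelling.not_exists_isClosedSaddleConnection_of_triangles isClosedSurface_octa4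
    hcorner (orderOf_eq_prime (by decide +kernel) (by decide +kernel))

theorem irrational_sqrt_two_div_three : Irrational (Real.sqrt (2 / 3)) := by
  have h := irrational_sqrt_ratCast_iff_of_nonneg (q := 2 / 3) (by norm_num)
  push_cast at h
  exact h.2 (by decide +kernel)

/-- The vector `u + √(2/3) * w` that is encoded by a pair `(u, w)` of integral vectors. -/
def addSqrtMul : (Fin 3 → ℤ) × (Fin 3 → ℤ) →+ Fin 3 → ℝ :=
  .mk' (fun x a => (x.1 a : ℝ) + Real.sqrt (2 / 3) * (x.2 a : ℝ)) fun x y => by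
    ext a
    simp only [Prod.fst_add, Prod.snd_add, Pi.add_apply, Int.cast_add]
    ring

theorem addSqrtMul_injective : Function.Injective addSqrtMul := by
  refine (injective_iff_map_eq_zero _).2 fun ⟨u, w⟩ h => ?_
  have hzero (a : Fin 3) : (u a : ℝ) + Real.sqrt (2 / 3) * (w a : ℝ) = 0 := congrFun h a
  have hw (a : Fin 3) : w a = 0 := by
    by_contra hw
    exact ((irrational_sqrt_two_div_three.mul_intCast hw).intCast_add (u a)).ne_zero (hzero a)
  exact Prod.ext (funext fun a => by simpa [hw a] using hzero a) (funext hw)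

/-- A basis of the lattice of the integral vectors whose coordinates have the same parity. -/
def bodyCentredBasis : Matrix (Fin 3) (Fin 3) ℤ := !![-1, 1, 1; 1, -1, 1; 1, 1, -1]

open Matrix in
theorem exists_eq_sum_smul_bodyCentredBasis_iff (x : (Fin 3 → ℤ) × (Fin 3 → ℤ)) :
    (∃ m : Fin 3 → ℤ, x = ∑ b, m b • ((2 : ℤ) • bodyCentredBasis b, bodyCentredBasis b)) ↔
      x.1 = (2 : ℤ) • x.2 ∧ ∀ b, 2 ∣ (x.2 ᵥ* !![0, 1, 1; 1, 0, 1; 1, 1, 0]) b := by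
  rw [← exists_eq_sum_smul_iff_forall_dvd (D := bodyCentredBasis) two_ne_zero (by decide),
    ← exists_and_left]
  refine exists_congr fun m => ?_
  simp only [Prod.ext_iff, Prod.fst_sum, Prod.snd_sum, Prod.smul_fst, Prod.smul_snd,
    smul_comm _ (2 : ℤ), ← Finset.smul_sum]
  exact and_congr_left fun h => by rw [h]

instance : Fintype truncatedOcta8.Face :=
  inferInstanceAs (Fintype ((Fin 3 ⊕ Fin 3) ⊕ Fin 4 × Fin 6))

instance : DecidableRel truncatedOcta8.SameEdge := fun e e' => decidable_of_iff _ <| Iff.symm <|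
  sameEdge_iff (V := truncatedOcta8Vertex) addSqrtMul_injective (fun _ _ => rfl)
    (fun b => by
      ext a
      fin_cases b <;> fin_cases a <;> simp [truncatedOcta8, addSqrtMul, bodyCentredBasis] <;> ring)
    exists_eq_sum_smul_bodyCentredBasis_iff e e'

theorem isClosedSurface_truncatedOcta8 : truncatedOcta8.IsClosedSurface := by
  unfold IsClosedSurface
  decide +kernel

/-- The labels of the first edges of the faces of Truncated Octa-8. -/
def truncatedOcta8Label : (Fin 3 ⊕ Fin 3) ⊕ Fin 4 × Fin 6 → Perm (Fin 5) :=
  Sum.elim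
    (Sum.elim ![1, c[1, 4, 2], c[1, 2, 4]] ![c[1, 2] * c[3, 4], c[2, 4, 3], c[1, 4, 3]])
    (fun f => ![
      ![c[0, 2, 4, 1], c[0, 4, 2, 1, 3], c[0, 1], c[0, 2, 4, 1, 3], c[0, 4, 2, 1], c[0, 1, 3]],
      ![c[0, 4, 3, 1], c[0, 2, 3], c[0, 3, 1] * c[2, 4], c[0, 4, 3], c[0, 2, 3, 1],
        c[0, 3] * c[2, 4]],
      ![c[0, 1] * c[2, 3, 4], c[0, 3] * c[1, 4], c[0, 2, 1] * c[3, 4], c[0, 1, 4, 2, 3],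
        c[0, 3, 4, 1], c[0, 2, 1, 4, 3]],
      ![c[0, 3, 2, 1], c[0, 1, 2, 4, 3], c[0, 4, 1] * c[2, 3], c[0, 3] * c[1, 2],
        c[0, 1] * c[2, 4, 3], c[0, 4, 1, 2, 3]]] f.1 f.2)

/-- A labelling of the edges of Truncated Octa-8 by permutations. -/
def truncatedOcta8Labelling : EdgeLabelling truncatedOcta8 (Perm (Fin 5)) where
  face := truncatedOcta8Label
  R := c[1, 2, 3, 4]
  E := swap 0 1
  R_pow := by decide +kernel
  E_mul_E := by decide +kernel
  sameEdge := by decide +kernel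

theorem truncatedOcta8_not_exists_isClosedSaddleConnection (f₀ : truncatedOcta8.Face) :
    ¬ ∃ γ, (truncatedOcta8.translationCover f₀).IsClosedSaddleConnection γ := by
  have hcorner : 4 < orderOf truncatedOcta8Labelling.cornerTurn :=
    lt_orderOf_of_pow_ne_one fun i hi h0 => by interval_cases i <;> decide +kernel
  have horder : orderOf (c[0, 4, 1, 2, 3] : Perm (Fin 5)) = 5 :=
    have : Fact (Nat.Prime 5) := ⟨Nat.prime_five⟩
    orderOf_eq_prime (by decide +kernel) (by decide +kernel)
  refine truncatedOcta8Labelling.not_exists_isClosedSaddleConnection_of_squares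
    isClosedSurface_truncatedOcta8 hcorner (c₀ := c[0, 4, 1, 2, 3])
    (g := truncatedOcta8Labelling.squareRight) (by decide +kernel)
    (horder ▸ Nat.prime_five) (Subgroup.subset_closure (mem_insert _ _)) ?_
  rw [mem_zpowers_iff_mem_range_orderOf, horder]
  decide +kernel

end PeriodicPolyhedralSurface

end

theorem mainTheorem3 :
    (∀ f₀, ¬ ∃ γ, (mucube.translationCover f₀).IsClosedSaddleConnection γ) ∧
    (∀ f₀, ¬ ∃ γ, (muoctahedron.translationCover f₀).IsClosedSaddleConnection γ) ∧
    (∀ f₀, ¬ ∃ γ, (mutetrahedron.translationCover f₀).IsClosedSaddleConnection γ) ∧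
    (∀ f₀, ¬ ∃ γ, (octa4.translationCover f₀).IsClosedSaddleConnection γ) ∧
    (∀ f₀, ¬ ∃ γ, (truncatedOcta8.translationCover f₀).IsClosedSaddleConnection γ) :=
  ⟨PeriodicPolyhedralSurface.mucube_not_exists_isClosedSaddleConnection,
    PeriodicPolyhedralSurface.muoctahedron_not_exists_isClosedSaddleConnection,
    PeriodicPolyhedralSurface.mutetrahedron_not_exists_isClosedSaddleConnection,
    PeriodicPolyhedralSurface.octa4_not_exists_isClosedSaddleConnection,
    PeriodicPolyhedralSurface.truncatedOcta8_not_exists_isClosedSaddleConnection⟩
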